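/- **Conventions.** Let $\mathfrak S_n$ be the symmetric group on $[n]=\{1,\dots,n\}$ (with $\mathfrak S_0$ trivial), generated by the adjacent transpositions $s_i=(i,i+1)$, $1\le i<n$. Let $\ell(w)$ be the minimal length of a word for $w$ in these generators. The longest element $w_0\in\mathfrak S_n$ is $w_0(i)=n+1-i$. For $X\subseteq\mathfrak S_n$ put $X^{w_0}=\{w_0\sigma w_0^{-1}\mid \sigma\in X\}$. Write $w\to w'$ if there is a (possibly empty) sequence of steps leading from $w$ to $w'$, where each step replaces $u$ by $s_ius_i$ for some $i$ such that $\ell(s_ius_i)\le \ell(u)$. Write $w\approx w'$ if $w\to w'$ and $w'\to w$; this is an equivalence relation. A composition $\alpha=(\alpha_1,\dots,\alpha_l)$ of $n$ is a finite (possibly empty) sequence of positive integers with sum $n$. It is *maximal* if for some $0\le k\le l$ the parts $\alpha_1,\dots,\alpha_k$ are even, the parts $\alpha_{k+1},\dots,\alpha_l$ are odd, and $\alpha_{k+1}\ge\dots\ge\alpha_l$. Let $x_{2i-1}=i$ and $x_{2i}=n-i+1$, and cut the list $(x_1,\dots,x_n)$ into consecutive pieces of lengths $\alpha_1,\dots,\alpha_l$.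 The *element in stair form* $\sigma_\alpha\in\mathfrak S_n$ is the permutation whose cycles are these pieces. Let $\Sigma_\alpha\subseteq\mathfrak S_n$ be the $\approx$-equivalence class of $\sigma_\alpha$. With $P(\sigma)$ denoting the set partition of $[n]$ into the orbits of $\sigma$, put $\Sigma_\alpha^\times=\{\sigma\in\Sigma_\alpha\mid P(\sigma)=P(\sigma_\alpha)\}$. For $n_1+n_2=n$ and $k=\lceil n_1/2\rceil$ define $\varphi_1\colon[n_1]\to[n]$ by $\varphi_1(i)=i$ if $i\le k$ and $\varphi_1(i)=i+n_2$ if $i>k$, and $\varphi_2\colon[n_2]\to[n]$ by $\varphi_2(i)=i+k$. The *inductive product* $\sigma_1\star\sigma_2\in\mathfrak S_n$ of $\sigma_1\in\mathfrak S_{n_1}$ and $\sigma_2\in\mathfrak S_{n_2}$ is the permutation whose cycles are the cycles of $\sigma_1$ with $\varphi_1$ applied to each entry together with the cycles of $\sigma_2$ with $\varphi_2$ applied to each entry. For sets put $X_1\star X_2=\{\sigma_1\star\sigma_2\mid\sigma_1\in X_1,\ \sigma_2\in X_2\}$. **Theorem.** Let $\alpha=(\alpha_1,\dots,\alpha_l)$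 be a maximal composition of $n$ with $l\ge1$, and put $n_1=\alpha_1$, $n_2=\alpha_2+\dots+\alpha_l$. The inductive product $\star\colon\mathfrak S_{n_1}\times\mathfrak S_{n_2}\to\mathfrak S_n$ is injective, and the following hold. 1. If $\alpha_1$ is even, then $\Sigma_\alpha=\Sigma_{(\alpha_1)}\star\Sigma_{(\alpha_2,\dots,\alpha_l)}$, and the map $\Sigma_{(\alpha_1)}\times\Sigma_{(\alpha_2,\dots,\alpha_l)}\to\Sigma_\alpha$, $(\sigma_1,\sigma_2)\mapsto\sigma_1\star\sigma_2$, is a bijection. 2. If $\alpha_1$ is odd, then $\Sigma^\times_\alpha=\Sigma^\times_{(\alpha_1)}\star\bigl(\Sigma^\times_{(\alpha_2,\dots,\alpha_l)}\bigr)^{w_0}$, where $w_0$ is the longest element of $\mathfrak S_{n_2}$, and the map $\Sigma^\times_{(\alpha_1)}\times\bigl(\Sigma^\times_{(\alpha_2,\dots,\alpha_l)}\bigr)^{w_0}\to\Sigma^\times_\alpha$, $(\sigma_1,\sigma_2)\mapsto\sigma_1\star\sigma_2$, is a bijection. -/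

import Mathlib

/-
Conventions: `Equiv.Perm (Fin n)` is the symmetric group on `n` letters, the letter `i + 1` of
`{1, …, n}` being `i : Fin n`. The product of permutations is composition of functions.
-/

namespace InductiveProduct

open Equiv

/-! ### The symmetric group as a Coxeter group -/

/-- The set of adjacent transpositions of the symmetric group. -/
def adjacentTranspositions (n : ℕ) : Set (Perm (Fin n)) :=
  {s | ∃ i j : Fin n, (i : ℕ) + 1 = j ∧ s = swap i j}

/-- `L` is a word for `w` in the adjacent transpositions. -/
def IsWord {n : ℕ} (L : List (Perm (Fin n))) (w : Perm (Fin n)) : Prop :=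
  (∀ s ∈ L, s ∈ adjacentTranspositions n) ∧ L.prod = w

/-- Every permutation has a word, so the minimum in the definition of the length is attained. -/
theorem exists_isWord {n : ℕ} (w : Perm (Fin n)) : ∃ L, IsWord L w := by
  cases n with
  | zero => exact ⟨[], by simp, Subsingleton.elim _ _⟩
  | succ n =>
    have h : w ∈ Submonoid.closure (adjacentTranspositions (n + 1)) := by
      have hle : Submonoid.closure
          (Set.range fun i : Fin n ↦ swap i.castSucc i.succ) ≤
          Submonoid.closure (adjacentTranspositions (n + 1)) := by
        apply Submonoid.closure_mono
        rintro _ ⟨i, rfl⟩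
        exact ⟨i.castSucc, i.succ, by simp, rfl⟩
      rw [Equiv.Perm.mclosure_swap_castSucc_succ] at hle
      exact hle (Submonoid.mem_top w)
    obtain ⟨L, hL, hp⟩ := Submonoid.exists_list_of_mem_closure h
    exact ⟨L, hL, hp⟩

/-- The Coxeter length: the minimal number of factors of a word for `w`. -/
noncomputable def coxLength {n : ℕ} (w : Perm (Fin n)) : ℕ :=
  sInf {k | ∃ L : List (Perm (Fin n)), IsWord L w ∧ L.length = k}

/-- The longest element `i ↦ n + 1 - i` of the symmetric group. -/
def w₀ (n : ℕ) : Perm (Fin n) := Fin.revPerm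

/-- The set `X` conjugated by the longest element, i.e. `{w₀ σ w₀⁻¹ | σ ∈ X}`. -/
def conjW₀ {n : ℕ} (X : Set (Perm (Fin n))) : Set (Perm (Fin n)) :=
  (fun σ ↦ w₀ n * σ * (w₀ n)⁻¹) '' X

/-! ### The equivalence relation `≈` -/

/-- An elementary step: `w' = s w s` for an adjacent transposition `s`, and `ℓ(w') ≤ ℓ(w)`. -/
def Step {n : ℕ} (w w' : Perm (Fin n)) : Prop :=
  ∃ s ∈ adjacentTranspositions n, w' = s * w * s ∧ coxLength w' ≤ coxLength w

/-- There is a (possibly empty) sequence of elementary steps from `w` to `w'`. -/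
def Arrow {n : ℕ} : Perm (Fin n) → Perm (Fin n) → Prop :=
  Relation.ReflTransGen Step

/-- The relation `w ≈ w'`: each of `w` and `w'` leads to the other by elementary steps. -/
def Approx {n : ℕ} (w w' : Perm (Fin n)) : Prop :=
  Arrow w w' ∧ Arrow w' w

/-! ### Maximal compositions and elements in stair form -/

/-- A composition is maximal if it consists of even parts (in any order), followed by weakly
decreasing odd parts. -/
def IsMaximal {n : ℕ} (α : Composition n) : Prop :=
  ∃ k ≤ α.length, (∀ a ∈ α.blocks.take k, Even a) ∧ (∀ a ∈ α.blocks.drop k, Odd a) ∧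
    (α.blocks.drop k).Pairwise (· ≥ ·)

/-- The sequence `1, n, 2, n - 1, 3, …` of length `n` (as `0, n - 1, 1, n - 2, 2, …`). -/
def stairSeq (n : ℕ) (p : Fin n) : Fin n :=
  if (p : ℕ) % 2 = 0 then ⟨p / 2, by omega⟩ else ⟨n - 1 - p / 2, by omega⟩

/-- The element in stair form: cut the sequence `1, n, 2, n - 1, …` into consecutive pieces whose
lengths are the parts of `α`; these pieces are the cycles. -/
def stairForm {n : ℕ} (α : Composition n) : Perm (Fin n) :=
  (((List.ofFn (stairSeq n)).splitWrtComposition α).map List.formPerm).prod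

/-- The `≈`-equivalence class of the element in stair form. -/
def SigmaClass {n : ℕ} (α : Composition n) : Set (Perm (Fin n)) :=
  {σ | Approx (stairForm α) σ}

/-- The set partition of the letters into the orbits of `σ`. -/
def orbitPartition {n : ℕ} (σ : Perm (Fin n)) : Set (Set (Fin n)) :=
  Set.range fun i ↦ {j | σ.SameCycle i j}

/-- The elements of the class with the same orbit partition as the element in stair form. -/
def SigmaCross {n : ℕ} (α : Composition n) : Set (Perm (Fin n)) :=
  {σ ∈ SigmaClass α | orbitPartition σ = orbitPartition (stairForm α)}

/-! ### The first part and the remaining parts of a composition -/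

/-- The first part `α₁`. -/
def firstPart {n : ℕ} (α : Composition n) (hl : 1 ≤ α.length) : ℕ :=
  α.blocks.head (List.length_pos_iff.mp hl)

theorem firstPart_pos {n : ℕ} (α : Composition n) (hl : 1 ≤ α.length) : 0 < firstPart α hl :=
  α.blocks_pos (List.head_mem _)

/-- The sum `α₂ + ⋯ + α_l` of the remaining parts. -/
def restSize {n : ℕ} (α : Composition n) : ℕ := α.blocks.tail.sum

/-- The one-part composition `(α₁)`. -/
def firstComp {n : ℕ} (α : Composition n) (hl : 1 ≤ α.length) : Composition (firstPart α hl) :=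
  Composition.single _ (firstPart_pos α hl)

/-- The composition `(α₂, …, α_l)`, possibly empty. -/
def restComp {n : ℕ} (α : Composition n) : Composition (restSize α) where
  blocks := α.blocks.tail
  blocks_pos h := α.blocks_pos (List.mem_of_mem_tail h)
  blocks_sum := rfl

theorem firstPart_add_restSize {n : ℕ} (α : Composition n) (hl : 1 ≤ α.length) :
    firstPart α hl + restSize α = n := by
  have h : (α.blocks.head (List.length_pos_iff.mp hl) :: α.blocks.tail).sum = n := by
    rw [List.cons_head_tail, α.blocks_sum]
  rw [List.sum_cons] at h
  exact h

/-! ### The inductive product -/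

section Product

variable {n₁ n₂ n : ℕ} (h : n₁ + n₂ = n)

/-- With `k = ⌈n₁ / 2⌉`: the map fixing the letters `≤ k` and adding `n₂` to the letters `> k`. -/
def phi₁ (i : Fin n₁) : Fin n :=
  if (i : ℕ) < (n₁ + 1) / 2 then ⟨i, by omega⟩ else ⟨i + n₂, by omega⟩

/-- With `k = ⌈n₁ / 2⌉`: the map adding `k` to each letter. -/
def phi₂ (i : Fin n₂) : Fin n :=
  ⟨i + (n₁ + 1) / 2, by omega⟩

theorem phi_bijective : Function.Bijective (Sum.elim (phi₁ h) (phi₂ h)) := by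
  rw [Fintype.bijective_iff_injective_and_card]
  refine ⟨?_, by simp [h]⟩
  rintro (i | i) (j | j) hij <;>
    simp only [Sum.elim_inl, Sum.elim_inr, phi₁, phi₂, Sum.inl.injEq, Sum.inr.injEq] at hij ⊢ <;>
    (try split_ifs at hij) <;> simp only [Fin.ext_iff, reduceCtorEq] at hij ⊢ <;> omega

/-- The letters of `n` as the disjoint union of the images of `phi₁` and `phi₂`. -/
noncomputable def phiEquiv : Fin n₁ ⊕ Fin n₂ ≃ Fin n :=
  Equiv.ofBijective _ (phi_bijective h)

/-- The inductive product: the cycles of `iprod h σ₁ σ₂` are those of `σ₁` with each letter `i`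
replaced by `phi₁ h i` and those of `σ₂` with each letter `i` replaced by `phi₂ h i`. -/
noncomputable def iprod (σ₁ : Perm (Fin n₁)) (σ₂ : Perm (Fin n₂)) : Perm (Fin n) :=
  (phiEquiv h).permCongr (Equiv.sumCongr σ₁ σ₂)

theorem iprod_phi₁ (σ₁ : Perm (Fin n₁)) (σ₂ : Perm (Fin n₂)) (i : Fin n₁) :
    iprod h σ₁ σ₂ (phi₁ h i) = phi₁ h (σ₁ i) := by
  have e : phi₁ h i = phiEquiv h (Sum.inl i) := rfl
  rw [e, iprod, Equiv.permCongr_apply, Equiv.symm_apply_apply]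
  rfl

theorem iprod_phi₂ (σ₁ : Perm (Fin n₁)) (σ₂ : Perm (Fin n₂)) (i : Fin n₂) :
    iprod h σ₁ σ₂ (phi₂ h i) = phi₂ h (σ₂ i) := by
  have e : phi₂ h i = phiEquiv h (Sum.inr i) := rfl
  rw [e, iprod, Equiv.permCongr_apply, Equiv.symm_apply_apply]
  rfl

/-- The set `X₁ ⋆ X₂` of all inductive products of elements of `X₁` and `X₂`. -/
def iprodSet (X₁ : Set (Perm (Fin n₁))) (X₂ : Set (Perm (Fin n₂))) : Set (Perm (Fin n)) :=
  {σ | ∃ σ₁ ∈ X₁, ∃ σ₂ ∈ X₂, iprod h σ₁ σ₂ = σ}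

end Product

end InductiveProduct

open InductiveProduct

/-!
The relation `≈` is generated by conjugations with adjacent transpositions `s` that keep the
length. By `invCount_swap_conj`, such a step at `w` is trivial unless exactly one of `w s` and
`s w` is longer than `w`, that is, unless `w` is *balanced* at the two letters. Balance is a
condition on the relative order of four letters, so it can be compared between an inductive
product and its factors along the order-preserving maps of letters `phi₁` and `phi₂`
(`approx_iff_balancedStep`, `balanced_blockPerm_inl`, `balanced_blockPerm_inr`).

*Even first part.* The elements of the class of the stair cycle exchange the lower and the upper
half of the letters. Therefore no balanced step of an inductive product mixes the two blocks of
letters (`BalancedStep.exists_of_iprod`), and the steps of the product are exactly the steps of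
its factors.

*Odd first part.* Here all parts are odd, and the elements of `SigmaCross α` are characterized
among the permutations with the same orbits as the element in stair form by having the same
length, which is the maximal one (`noninvCount_stairForm_le_and_approx`, `mem_sigmaCross_iff`). As
the number of noninversions of an inductive product is the sum of those of the factors and a mixed
term that is smallest for the longest cycles (`noninvCount_iprod`, `noninvCount_iprod_eq_iff`),
the theorem follows from this characterization, which is proved by induction on the number of
parts.

For a single part `2 h + 1`, write a full cycle as `t₁ ⋯ t_r w₀` with adjacent transpositions
`t_i` and `r` its number of noninversions. Conjugation by `w₀` arranges the adjacent
transpositions in `h` pairs, and transitivity forces every pair to occur, so `r ≥ h`, and for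
`r = h` every pair occurs exactly once (`IsFullCycle.exists_word`). Conjugating by `t₁` moves this
letter to the other end of the word and replaces it by its partner. Together with the commutation
of distant generators these moves connect all such words (`wordEquiv_canonicalWord`), so the
longest full cycles form one class (`IsFullCycle.approx`). For several parts, a path between
longest full cycles has to be lifted to inductive products. The only step that does not lift at
once is the one at the two letters that the inner block separates. There, the middle letter `h`
can be moved through the inner block by balanced steps, because it is mapped to one half and is
the image of a letter in the other half (`Oscillates.middle`, `BalancedStep.approx_iprod`).
-/

namespace InductiveProduct

open Equiv Finset

/-! ### Inversions and the Coxeter length -/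

/-- The set of inversions of `w`: pairs of positions `x < y` whose values are in the wrong order. -/
def inversions {n : ℕ} (w : Perm (Fin n)) : Finset (Fin n × Fin n) :=
  univ.filter fun p ↦ p.1 < p.2 ∧ w p.2 < w p.1

theorem mem_inversions {n : ℕ} {w : Perm (Fin n)} {x y : Fin n} :
    (x, y) ∈ inversions w ↔ x < y ∧ w y < w x := by
  simp [inversions]

/-- The number of inversions of `w`. -/
def invCount {n : ℕ} (w : Perm (Fin n)) : ℕ := #(inversions w)

theorem swap_lt_swap_iff {n : ℕ} {i j x y : Fin n} (hij : (i : ℕ) + 1 = j)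
    (h₁ : ¬(x = i ∧ y = j)) (h₂ : ¬(x = j ∧ y = i)) : swap i j x < swap i j y ↔ x < y := by
  simp only [swap_apply_def, Fin.ext_iff, Fin.lt_def] at *
  split_ifs <;> omega

theorem invCount_mul_swap_of_lt {n : ℕ} {i j : Fin n} (hij : (i : ℕ) + 1 = j) (w : Perm (Fin n))
    (h : w i < w j) : invCount (w * swap i j) = invCount w + 1 := by
  have hlt : i < j := by rw [Fin.lt_def]; omega
  have hnot : (j, i) ∉ inversions w := by simp [inversions, hlt.le]
  have key : (inversions (w * swap i j)).map
      ((swap i j).prodCongr (swap i j)).toEmbedding = insert (j, i) (inversions w) := by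
    ext ⟨x, y⟩
    rw [mem_map_equiv]
    simp only [prodCongr_symm, symm_swap, prodCongr_apply, Prod.map_apply]
    simp only [mem_insert, mem_inversions, Prod.mk.injEq, Perm.mul_apply, swap_apply_self]
    by_cases h₀ : x = y
    · subst h₀
      have : ¬(x = j ∧ x = i) := fun ⟨a, b⟩ ↦ hlt.ne (b.symm.trans a)
      simp [this]
    by_cases h₁ : x = i ∧ y = j
    · obtain ⟨rfl, rfl⟩ := h₁
      simp [hlt.ne, h.le]
    by_cases h₂ : x = j ∧ y = i
    · obtain ⟨rfl, rfl⟩ := h₂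
      simp [hlt, h]
    rw [swap_lt_swap_iff hij h₁ h₂]
    simp [h₂]
  rw [invCount, ← card_map, key, card_insert_of_notMem hnot, invCount]

theorem invCount_mul_swap_of_gt {n : ℕ} {i j : Fin n} (hij : (i : ℕ) + 1 = j) (w : Perm (Fin n))
    (h : w j < w i) : invCount (w * swap i j) + 1 = invCount w := by
  rw [← invCount_mul_swap_of_lt hij (w * swap i j) (by simpa using h), mul_assoc, swap_mul_self,
    mul_one]

theorem invCount_inv {n : ℕ} (w : Perm (Fin n)) : invCount w⁻¹ = invCount w := by
  refine card_bij (fun p _ ↦ (w⁻¹ p.2, w⁻¹ p.1)) ?_ ?_ ?_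
  · rintro ⟨x, y⟩ h
    simpa [inversions, and_comm] using h
  · rintro ⟨x, y⟩ _ ⟨x', y'⟩ _ h
    simp only [Prod.mk.injEq, EmbeddingLike.apply_eq_iff_eq] at h
    exact Prod.ext h.2 h.1
  · rintro ⟨x, y⟩ h
    exact ⟨(w y, w x), by simpa [inversions, and_comm] using h, by simp⟩

theorem invCount_swap_mul_of_lt {n : ℕ} {i j : Fin n} (hij : (i : ℕ) + 1 = j) (w : Perm (Fin n))
    (h : w⁻¹ i < w⁻¹ j) : invCount (swap i j * w) = invCount w + 1 := by
  rw [← invCount_inv, mul_inv_rev, swap_inv, invCount_mul_swap_of_lt hij _ h, invCount_inv]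

theorem invCount_swap_mul_of_gt {n : ℕ} {i j : Fin n} (hij : (i : ℕ) + 1 = j) (w : Perm (Fin n))
    (h : w⁻¹ j < w⁻¹ i) : invCount (swap i j * w) + 1 = invCount w := by
  rw [← invCount_inv, mul_inv_rev, swap_inv, invCount_mul_swap_of_gt hij _ h, invCount_inv]

theorem invCount_one (n : ℕ) : invCount (1 : Perm (Fin n)) = 0 := by
  refine card_eq_zero.2 (eq_empty_of_forall_notMem ?_)
  rintro ⟨x, y⟩ h
  exact (mem_inversions.1 h).1.asymm (mem_inversions.1 h).2

theorem invCount_le_length {n : ℕ} {L : List (Perm (Fin n))} {w : Perm (Fin n)} (h : IsWord L w) :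
    invCount w ≤ L.length := by
  obtain ⟨hL, rfl⟩ := h
  induction L with
  | nil => simp [invCount_one]
  | cons s L ih =>
    obtain ⟨i, j, hij, rfl⟩ := hL s (by simp)
    have := ih fun t ht ↦ hL t (by simp [ht])
    rw [List.prod_cons, List.length_cons]
    have hne : (L.prod)⁻¹ i ≠ (L.prod)⁻¹ j := by
      simp [Fin.ext_iff]; omega
    rcases hne.lt_or_gt with h | h
    · rw [invCount_swap_mul_of_lt hij _ h]; omega
    · have := invCount_swap_mul_of_gt hij _ h; omega

theorem eq_one_of_forall_lt {n : ℕ} {w : Perm (Fin n)}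
    (h : ∀ i j : Fin n, (i : ℕ) + 1 = j → w i < w j) : w = 1 := by
  have hm : StrictMono w := by
    cases n with
    | zero => exact fun i ↦ i.elim0
    | succ n => exact Fin.strictMono_iff_lt_succ.2 fun i ↦ h _ _ (by simp)
  have := Subsingleton.elim (hm.orderIsoOfSurjective w w.surjective) (OrderIso.refl _)
  ext x
  exact congrArg Fin.val (DFunLike.congr_fun this x)

theorem exists_isWord_length_eq_invCount {n : ℕ} (w : Perm (Fin n)) :
    ∃ L, IsWord L w ∧ L.length = invCount w := by
  induction hk : invCount w generalizing w with
  | zero =>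
    refine ⟨[], ⟨by simp, ?_⟩, rfl⟩
    refine (eq_one_of_forall_lt fun i j hij ↦ ?_).symm
    by_contra hlt
    have hne : w i ≠ w j := by simp [Fin.ext_iff]; omega
    have := invCount_mul_swap_of_gt hij w (lt_of_le_of_ne (not_lt.1 hlt) hne.symm)
    omega
  | succ k ih =>
    have : ∃ i j : Fin n, (i : ℕ) + 1 = j ∧ w j < w i := by
      by_contra! hc
      have : w = 1 := eq_one_of_forall_lt fun i j hij ↦
        lt_of_le_of_ne (hc i j hij) (by simp [Fin.ext_iff]; omega)
      rw [this, invCount_one] at hk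
      omega
    obtain ⟨i, j, hij, hlt⟩ := this
    obtain ⟨L, ⟨hL, hp⟩, hlen⟩ := ih (w * swap i j) (by
      have := invCount_mul_swap_of_gt hij w hlt; omega)
    refine ⟨L ++ [swap i j], ⟨?_, ?_⟩, by simp [hlen]⟩
    · intro s hs
      rcases List.mem_append.1 hs with hs | hs
      · exact hL s hs
      · exact ⟨i, j, hij, by simpa using hs⟩
    · simp [hp, mul_assoc]

theorem coxLength_eq_invCount {n : ℕ} (w : Perm (Fin n)) : coxLength w = invCount w := by
  obtain ⟨L, hL, hlen⟩ := exists_isWord_length_eq_invCount w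
  refine le_antisymm (Nat.sInf_le ⟨L, hL, hlen⟩) (le_csInf ⟨_, L, hL, hlen⟩ ?_)
  rintro _ ⟨L', hL', rfl⟩
  exact invCount_le_length hL'

/-! ### IsBalancedAt conjugation steps -/

/-- For adjacent letters `i` and `j = i + 1`, exactly one of multiplying `w` by `swap i j` on the
right and multiplying it by `swap i j` on the left lengthens `w`. -/
def IsBalancedAt {n : ℕ} (w : Perm (Fin n)) (i j : Fin n) : Prop :=
  w i < w j ↔ w⁻¹ j < w⁻¹ i

/-- Conjugation by the transposition of two adjacent letters at which the permutation is balanced.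
These are exactly the nontrivial steps that preserve the length. -/
def BalancedStep {n : ℕ} (w w' : Perm (Fin n)) : Prop :=
  ∃ i j : Fin n, (i : ℕ) + 1 = j ∧ IsBalancedAt w i j ∧ w' = swap i j * w * swap i j

theorem swap_conj_eq_self {n : ℕ} {i j : Fin n} {w : Perm (Fin n)}
    (h : w⁻¹ i = i ∧ w⁻¹ j = j ∨ w⁻¹ i = j ∧ w⁻¹ j = i) : swap i j * w * swap i j = w := by
  have : w * swap i j = swap (w i) (w j) * w := mul_swap_eq_swap_mul _ _ _
  rw [mul_assoc, this]
  rcases h with ⟨h₁, h₂⟩ | ⟨h₁, h₂⟩ <;> rw [Perm.inv_eq_iff_eq] at h₁ h₂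
  · rw [← h₁, ← h₂, ← mul_assoc, swap_mul_self, one_mul]
  · rw [← h₁, ← h₂, swap_comm j i, ← mul_assoc, swap_mul_self, one_mul]

theorem invCount_swap_conj {n : ℕ} {i j : Fin n} (hij : (i : ℕ) + 1 = j) (w : Perm (Fin n))
    (hw : swap i j * w * swap i j ≠ w) :
    invCount (swap i j * w * swap i j) = invCount w ↔ IsBalancedAt w i j := by
  have hne : i ≠ j := by rw [Ne, Fin.ext_iff]; omega
  have hne₁ : w i ≠ w j := w.injective.ne hne
  have hne₂ : w⁻¹ i ≠ w⁻¹ j := w⁻¹.injective.ne hne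
  have hs : (w * swap i j)⁻¹ i < (w * swap i j)⁻¹ j ↔ w⁻¹ i < w⁻¹ j := by
    rw [mul_inv_rev, swap_inv, Perm.mul_apply, Perm.mul_apply]
    exact swap_lt_swap_iff hij (fun h ↦ hw (swap_conj_eq_self (.inl h)))
      fun h ↦ hw (swap_conj_eq_self (.inr h))
  have hne₃ : (w * swap i j)⁻¹ i ≠ (w * swap i j)⁻¹ j := (w * swap i j)⁻¹.injective.ne hne
  rw [mul_assoc]
  rcases hne₁.lt_or_gt with h₁ | h₁ <;> rcases hne₂.lt_or_gt with h₂ | h₂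
  · have e₁ := invCount_mul_swap_of_lt hij w h₁
    have e₂ := invCount_swap_mul_of_lt hij _ (hs.2 h₂)
    exact iff_of_false (by omega) fun h ↦ h₂.asymm (h.1 h₁)
  · have e₁ := invCount_mul_swap_of_lt hij w h₁
    have e₂ := invCount_swap_mul_of_gt hij _
      (lt_of_le_of_ne (not_lt.1 (hs.not.2 h₂.asymm)) hne₃.symm)
    exact iff_of_true (by omega) (iff_of_true h₁ h₂)
  · have e₁ := invCount_mul_swap_of_gt hij w h₁
    have e₂ := invCount_swap_mul_of_lt hij _ (hs.2 h₂)
    exact iff_of_true (by omega) (iff_of_false h₁.asymm h₂.asymm)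
  · have e₁ := invCount_mul_swap_of_gt hij w h₁
    have e₂ := invCount_swap_mul_of_gt hij _
      (lt_of_le_of_ne (not_lt.1 (hs.not.2 h₂.asymm)) hne₃.symm)
    exact iff_of_false (by omega) fun h ↦ h₁.asymm (h.2 h₂)

theorem BalancedStep.invCount_eq {n : ℕ} {w w' : Perm (Fin n)} (h : BalancedStep w w') :
    invCount w' = invCount w := by
  obtain ⟨i, j, hij, hb, rfl⟩ := h
  by_cases hw : swap i j * w * swap i j = w
  · rw [hw]
  · exact (invCount_swap_conj hij w hw).2 hb

theorem swap_conj_swap_conj {n : ℕ} (i j : Fin n) (w : Perm (Fin n)) :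
    swap i j * (swap i j * w * swap i j) * swap i j = w := by
  simp [mul_assoc]

theorem approx_symm {n : ℕ} {w w' : Perm (Fin n)} (h : Approx w w') : Approx w' w := ⟨h.2, h.1⟩

theorem approx_refl {n : ℕ} (w : Perm (Fin n)) : Approx w w := ⟨.refl, .refl⟩

theorem approx_trans {n : ℕ} {u v w : Perm (Fin n)} (h : Approx u v) (h' : Approx v w) :
    Approx u w := ⟨h.1.trans h'.1, h'.2.trans h.2⟩

theorem approx_of_invCount_eq {n : ℕ} {w s : Perm (Fin n)} (hs : s ∈ adjacentTranspositions n)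
    (h : invCount (s * w * s) = invCount w) : Approx w (s * w * s) := by
  refine ⟨.single ⟨s, hs, rfl, ?_⟩, .single ⟨s, hs, ?_, ?_⟩⟩
  · rw [coxLength_eq_invCount, coxLength_eq_invCount, h]
  · obtain ⟨i, j, -, rfl⟩ := hs
    exact (swap_conj_swap_conj i j w).symm
  · rw [coxLength_eq_invCount, coxLength_eq_invCount, h]

theorem BalancedStep.approx {n : ℕ} {w w' : Perm (Fin n)} (h : BalancedStep w w') :
    Approx w w' := by
  have h' := h.invCount_eq
  obtain ⟨i, j, hij, -, rfl⟩ := h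
  exact approx_of_invCount_eq ⟨i, j, hij, rfl⟩ h'

theorem Arrow.invCount_le {n : ℕ} {w w' : Perm (Fin n)} (h : Arrow w w') :
    invCount w' ≤ invCount w := by
  induction h with
  | refl => rfl
  | tail _ h ih =>
    obtain ⟨s, -, -, hle⟩ := h
    rw [coxLength_eq_invCount, coxLength_eq_invCount] at hle
    exact hle.trans ih

theorem Approx.invCount_eq {n : ℕ} {w w' : Perm (Fin n)} (h : Approx w w') :
    invCount w' = invCount w :=
  le_antisymm h.1.invCount_le h.2.invCount_le

/-- The classes of `≈` are the components of the graph of balanced steps: a path that returns to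
its starting length never loses length, and a step that keeps the length without being balanced is
trivial. -/
theorem approx_iff_balancedStep {n : ℕ} {w w' : Perm (Fin n)} :
    Approx w w' ↔ Relation.ReflTransGen BalancedStep w w' := by
  constructor
  · rintro ⟨h, h'⟩
    have hle := Arrow.invCount_le h'
    clear h'
    induction h with
    | refl => exact .refl
    | @tail u v hu hv ih =>
      have hu' := Arrow.invCount_le hu
      obtain ⟨s, ⟨i, j, hij, rfl⟩, rfl, hl⟩ := hv
      rw [coxLength_eq_invCount, coxLength_eq_invCount] at hl
      by_cases hw : swap i j * u * swap i j = u
      · rw [hw] at hle ⊢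
        exact ih hle
      · exact (ih (hle.trans hl)).tail
          ⟨i, j, hij, (invCount_swap_conj hij u hw).1 (by omega), rfl⟩
  · intro h
    induction h with
    | refl => exact approx_refl _
    | tail _ h ih => exact approx_trans ih h.approx

/-- A property of permutations that is preserved by balanced steps is preserved by `≈`. -/
theorem Approx.induction {n : ℕ} {w w' : Perm (Fin n)} (h : Approx w w')
    {p : Perm (Fin n) → Prop} (h₀ : p w) (hs : ∀ u v, BalancedStep u v → p u → p v) : p w' := by
  have := approx_iff_balancedStep.1 h
  clear h
  induction this with
  | refl => exact h₀
  | tail _ h ih => exact hs _ _ h ih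

/-! ### Permutations built from two blocks of letters -/

section Block

variable {n₁ n₂ n : ℕ}

/-- The permutation of `n` letters that acts as `σ₁` on the letters `e (inl i)` and as `σ₂` on the
letters `e (inr i)`. The inductive product is the case `e = phiEquiv h`. -/
def blockPerm (e : Fin n₁ ⊕ Fin n₂ ≃ Fin n) (σ₁ : Perm (Fin n₁)) (σ₂ : Perm (Fin n₂)) :
    Perm (Fin n) :=
  e.permCongr (sumCongr σ₁ σ₂)

variable (e : Fin n₁ ⊕ Fin n₂ ≃ Fin n) (σ₁ τ₁ : Perm (Fin n₁)) (σ₂ τ₂ : Perm (Fin n₂))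

theorem blockPerm_inl (a : Fin n₁) : blockPerm e σ₁ σ₂ (e (.inl a)) = e (.inl (σ₁ a)) := by
  simp [blockPerm, permCongr_apply]

theorem blockPerm_inr (b : Fin n₂) : blockPerm e σ₁ σ₂ (e (.inr b)) = e (.inr (σ₂ b)) := by
  simp [blockPerm, permCongr_apply]

theorem blockPerm_mul :
    blockPerm e σ₁ σ₂ * blockPerm e τ₁ τ₂ = blockPerm e (σ₁ * τ₁) (σ₂ * τ₂) := by
  ext x
  obtain ⟨x | x, rfl⟩ := e.surjective x <;> simp [blockPerm_inl, blockPerm_inr]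

theorem blockPerm_inv : (blockPerm e σ₁ σ₂)⁻¹ = blockPerm e σ₁⁻¹ σ₂⁻¹ := by
  rw [inv_eq_iff_mul_eq_one, blockPerm_mul]
  ext x
  obtain ⟨x | x, rfl⟩ := e.surjective x <;> simp [blockPerm_inl, blockPerm_inr]

theorem blockPerm_zpow (k : ℤ) : blockPerm e σ₁ σ₂ ^ k = blockPerm e (σ₁ ^ k) (σ₂ ^ k) := by
  let f : Perm (Fin n₁) × Perm (Fin n₂) →* Perm (Fin n) :=
    MonoidHom.mk' (fun p ↦ blockPerm e p.1 p.2) fun p q ↦ (blockPerm_mul e _ _ _ _).symm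
  exact (map_zpow f (σ₁, σ₂) k).symm

theorem blockPerm_swap_one (a b : Fin n₁) :
    blockPerm e (swap a b) 1 = swap (e (.inl a)) (e (.inl b)) := by
  ext x
  obtain ⟨x | x, rfl⟩ := e.surjective x <;>
    simp [blockPerm_inl, blockPerm_inr, swap_apply_def, apply_ite e, apply_ite Sum.inl]

theorem blockPerm_one_swap (a b : Fin n₂) :
    blockPerm e 1 (swap a b) = swap (e (.inr a)) (e (.inr b)) := by
  ext x
  obtain ⟨x | x, rfl⟩ := e.surjective x <;>
    simp [blockPerm_inl, blockPerm_inr, swap_apply_def, apply_ite e, apply_ite Sum.inr]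

theorem swap_conj_blockPerm_inl (a b : Fin n₁) :
    swap (e (.inl a)) (e (.inl b)) * blockPerm e σ₁ σ₂ * swap (e (.inl a)) (e (.inl b)) =
      blockPerm e (swap a b * σ₁ * swap a b) σ₂ := by
  simp [← blockPerm_swap_one, blockPerm_mul]

theorem swap_conj_blockPerm_inr (a b : Fin n₂) :
    swap (e (.inr a)) (e (.inr b)) * blockPerm e σ₁ σ₂ * swap (e (.inr a)) (e (.inr b)) =
      blockPerm e σ₁ (swap a b * σ₂ * swap a b) := by
  simp [← blockPerm_one_swap, blockPerm_mul]

theorem conj_blockPerm (s : Perm (Fin n)) :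
    s * blockPerm e σ₁ σ₂ * s⁻¹ = blockPerm (e.trans s) σ₁ σ₂ := by
  rw [mul_inv_eq_iff_eq_mul]
  ext x
  obtain ⟨x | x, rfl⟩ := e.surjective x
  · simpa [blockPerm_inl] using (congrArg Fin.val (blockPerm_inl (e.trans s) σ₁ σ₂ x)).symm
  · simpa [blockPerm_inr] using (congrArg Fin.val (blockPerm_inr (e.trans s) σ₁ σ₂ x)).symm

theorem blockPerm_injective :
    Function.Injective fun p : Perm (Fin n₁) × Perm (Fin n₂) ↦ blockPerm e p.1 p.2 := by
  rintro ⟨σ₁, σ₂⟩ ⟨τ₁, τ₂⟩ h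
  refine Prod.ext (Equiv.ext fun x ↦ ?_) (Equiv.ext fun x ↦ ?_)
  · simpa [blockPerm_inl] using DFunLike.congr_fun h (e (.inl x))
  · simpa [blockPerm_inr] using DFunLike.congr_fun h (e (.inr x))

variable {e}

theorem balanced_blockPerm_inl (he : StrictMono (e ∘ .inl)) {a b : Fin n₁} :
    IsBalancedAt (blockPerm e σ₁ σ₂) (e (.inl a)) (e (.inl b)) ↔ IsBalancedAt σ₁ a b := by
  simp only [IsBalancedAt, blockPerm_inv, blockPerm_inl]
  exact iff_congr he.lt_iff_lt he.lt_iff_lt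

theorem balanced_blockPerm_inr (he : StrictMono (e ∘ .inr)) {a b : Fin n₂} :
    IsBalancedAt (blockPerm e σ₁ σ₂) (e (.inr a)) (e (.inr b)) ↔ IsBalancedAt σ₂ a b := by
  simp only [IsBalancedAt, blockPerm_inv, blockPerm_inr]
  exact iff_congr he.lt_iff_lt he.lt_iff_lt

theorem sameCycle_blockPerm_inl {a b : Fin n₁} :
    (blockPerm e σ₁ σ₂).SameCycle (e (.inl a)) (e (.inl b)) ↔ σ₁.SameCycle a b := by
  have (k : ℤ) : (blockPerm e σ₁ σ₂ ^ k) (e (.inl a)) = e (.inl ((σ₁ ^ k) a)) := by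
    rw [blockPerm_zpow, blockPerm_inl]
  simp [Perm.SameCycle, this]

theorem sameCycle_blockPerm_inr {a b : Fin n₂} :
    (blockPerm e σ₁ σ₂).SameCycle (e (.inr a)) (e (.inr b)) ↔ σ₂.SameCycle a b := by
  have (k : ℤ) : (blockPerm e σ₁ σ₂ ^ k) (e (.inr a)) = e (.inr ((σ₂ ^ k) a)) := by
    rw [blockPerm_zpow, blockPerm_inr]
  simp [Perm.SameCycle, this]

theorem not_sameCycle_blockPerm {a : Fin n₁} {b : Fin n₂} :
    ¬ (blockPerm e σ₁ σ₂).SameCycle (e (.inl a)) (e (.inr b)) := by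
  rintro ⟨k, hk⟩
  rw [blockPerm_zpow, blockPerm_inl] at hk
  simp at hk

end Block

/-- The permutations `σ` and `τ` have the same orbits. -/
def SameOrbits {n : ℕ} (σ τ : Perm (Fin n)) : Prop :=
  ∀ x y, σ.SameCycle x y ↔ τ.SameCycle x y

theorem orbitPartition_eq_iff {n : ℕ} {σ τ : Perm (Fin n)} :
    orbitPartition σ = orbitPartition τ ↔ SameOrbits σ τ := by
  constructor
  · intro h x y
    have hx : {j | σ.SameCycle x j} ∈ orbitPartition τ := h ▸ Set.mem_range_self x
    obtain ⟨z, hz⟩ := hx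
    have hz (j) : τ.SameCycle z j ↔ σ.SameCycle x j := Set.ext_iff.1 hz j
    rw [← hz]
    have hzx := (hz x).2 (.refl _ _)
    exact ⟨hzx.symm.trans, hzx.trans⟩
  · intro h
    have : (fun i ↦ {j | σ.SameCycle i j}) = fun i ↦ {j | τ.SameCycle i j} :=
      funext fun x ↦ Set.ext fun y ↦ h x y
    rw [orbitPartition, this, orbitPartition]

section Block

variable {n₁ n₂ n : ℕ} {e : Fin n₁ ⊕ Fin n₂ ≃ Fin n}

theorem sameOrbits_blockPerm {σ₁ τ₁ : Perm (Fin n₁)} {σ₂ τ₂ : Perm (Fin n₂)} :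
    SameOrbits (blockPerm e σ₁ σ₂) (blockPerm e τ₁ τ₂) ↔ SameOrbits σ₁ τ₁ ∧ SameOrbits σ₂ τ₂ := by
  constructor
  · exact fun h ↦ ⟨fun x y ↦ by simpa [sameCycle_blockPerm_inl] using h (e (.inl x)) (e (.inl y)),
      fun x y ↦ by simpa [sameCycle_blockPerm_inr] using h (e (.inr x)) (e (.inr y))⟩
  · rintro ⟨h₁, h₂⟩ x y
    obtain ⟨x | x, rfl⟩ := e.surjective x <;> obtain ⟨y | y, rfl⟩ := e.surjective y
    · simpa [sameCycle_blockPerm_inl] using h₁ x y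
    · simp [not_sameCycle_blockPerm]
    · rw [Perm.sameCycle_comm, Perm.sameCycle_comm (f := blockPerm e τ₁ τ₂)]
      simp [not_sameCycle_blockPerm]
    · simpa [sameCycle_blockPerm_inr] using h₂ x y

theorem SameOrbits.exists_blockPerm {σ : Perm (Fin n)} {τ₁ : Perm (Fin n₁)} {τ₂ : Perm (Fin n₂)}
    (h : SameOrbits σ (blockPerm e τ₁ τ₂)) : ∃ σ₁ σ₂, σ = blockPerm e σ₁ σ₂ := by
  have hmaps : Set.MapsTo (e.symm.permCongr σ) (Set.range .inl) (Set.range .inl) := by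
    rintro _ ⟨a, rfl⟩
    have ha : (blockPerm e τ₁ τ₂).SameCycle (e (.inl a)) (σ (e (.inl a))) :=
      (h _ _).1 (Perm.sameCycle_apply_right.2 (.refl _ _))
    obtain ⟨b | b, hb⟩ := e.surjective (σ (e (.inl a)))
    · exact ⟨b, by simp [permCongr_apply, ← hb]⟩
    · rw [← hb] at ha
      exact absurd ha (not_sameCycle_blockPerm _ _)
  obtain ⟨⟨σ₁, σ₂⟩, hσ⟩ := Perm.mem_sumCongrHom_range_of_perm_mapsTo_inl hmaps
  refine ⟨σ₁, σ₂, Equiv.ext fun x ↦ ?_⟩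
  have := DFunLike.congr_fun hσ (e.symm x)
  simp only [Perm.sumCongrHom_apply, permCongr_apply, symm_symm, apply_symm_apply] at this
  rw [blockPerm, permCongr_apply, this, apply_symm_apply]

end Block

/-! ### Pairs in order -/

/-- The number of pairs of positions `x < y` whose values are in the right order. -/
def noninvCount {n : ℕ} (w : Perm (Fin n)) : ℕ :=
  #(univ.filter fun p : Fin n × Fin n ↦ p.1 < p.2 ∧ w p.1 < w p.2)

theorem noninvCount_add_invCount {n : ℕ} (w : Perm (Fin n)) :
    noninvCount w + invCount w = #(univ.filter fun p : Fin n × Fin n ↦ p.1 < p.2) := by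
  rw [noninvCount, invCount, inversions, ← filter_filter, ← filter_filter]
  convert card_filter_add_card_filter_not (s := univ.filter fun p : Fin n × Fin n ↦ p.1 < p.2)
    (fun p ↦ w p.1 < w p.2) using 2
  refine congrArg card (filter_congr fun p hp ↦ ?_)
  have : w p.1 ≠ w p.2 := w.injective.ne (mem_filter.1 hp).2.ne
  rw [not_lt]
  exact ⟨le_of_lt, fun h ↦ lt_of_le_of_ne h this.symm⟩

theorem noninvCount_eq_iff {n : ℕ} {w w' : Perm (Fin n)} :
    noninvCount w = noninvCount w' ↔ invCount w = invCount w' := by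
  have := noninvCount_add_invCount w
  have := noninvCount_add_invCount w'
  omega

theorem noninvCount_eq_sum {n : ℕ} (w : Perm (Fin n)) :
    noninvCount w = ∑ x, ∑ y, if x < y ∧ w x < w y then 1 else 0 := by
  rw [noninvCount, card_filter, Fintype.sum_prod_type]

theorem w₀_apply {n : ℕ} (x : Fin n) : w₀ n x = x.rev := rfl

theorem w₀_mul_self (n : ℕ) : w₀ n * w₀ n = 1 := by
  ext x; simp [w₀_apply]

theorem w₀_inv (n : ℕ) : (w₀ n)⁻¹ = w₀ n := inv_eq_of_mul_eq_one_left (w₀_mul_self n)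

theorem invCount_mul_w₀ {n : ℕ} (w : Perm (Fin n)) : invCount (w * w₀ n) = noninvCount w := by
  refine card_bij (fun p _ ↦ (p.2.rev, p.1.rev)) ?_ ?_ ?_
  · rintro ⟨x, y⟩ h
    rw [mem_inversions] at h
    simpa [w₀_apply] using h
  · rintro ⟨x, y⟩ _ ⟨x', y'⟩ _ h
    simp only [Prod.mk.injEq, Fin.rev_inj] at h
    exact Prod.ext h.2 h.1
  · rintro ⟨x, y⟩ h
    exact ⟨(y.rev, x.rev), mem_inversions.2 (by simpa [w₀_apply] using h), by simp⟩

section Product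

variable {n₁ n₂ n : ℕ} (h : n₁ + n₂ = n)

theorem phiEquiv_inl (a : Fin n₁) : phiEquiv h (.inl a) = phi₁ h a := rfl

theorem phiEquiv_inr (b : Fin n₂) : phiEquiv h (.inr b) = phi₂ h b := rfl

theorem iprod_eq_blockPerm (σ₁ : Perm (Fin n₁)) (σ₂ : Perm (Fin n₂)) :
    iprod h σ₁ σ₂ = blockPerm (phiEquiv h) σ₁ σ₂ := rfl

theorem phi₁_strictMono : StrictMono (phi₁ h) := by
  intro a b hab
  simp only [phi₁, Fin.lt_def] at *
  split_ifs <;> simp only [] <;> omega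

theorem phi₂_strictMono : StrictMono (phi₂ h) := by
  intro a b hab
  simp only [phi₂, Fin.lt_def] at *
  omega

theorem phi₁_lt_phi₂_iff {a : Fin n₁} {b : Fin n₂} :
    phi₁ h a < phi₂ h b ↔ (a : ℕ) < (n₁ + 1) / 2 := by
  simp only [phi₁, phi₂, Fin.lt_def]
  split_ifs <;> simp only [] <;> omega

theorem phi₂_lt_phi₁_iff {a : Fin n₁} {b : Fin n₂} :
    phi₂ h b < phi₁ h a ↔ (n₁ + 1) / 2 ≤ (a : ℕ) := by
  simp only [phi₁, phi₂, Fin.lt_def]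
  split_ifs <;> simp only [] <;> omega

/-- The number of letters that stay in the lower half or stay in the upper half under `σ`, the
middle letter (if there is one) being counted to the lower half. -/
def stayCount {n : ℕ} (σ : Perm (Fin n)) : ℕ :=
  #(univ.filter fun a : Fin n ↦ (a : ℕ) < (n + 1) / 2 ↔ (σ a : ℕ) < (n + 1) / 2)

/-- A letter of the outer block is in order with respect to all letters of the inner block or to
none of them, the former if it stays in its half. -/
theorem noninvCount_iprod (σ₁ : Perm (Fin n₁)) (σ₂ : Perm (Fin n₂)) :
    noninvCount (iprod h σ₁ σ₂) =
      noninvCount σ₁ + noninvCount σ₂ + n₂ * stayCount σ₁ := by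
  simp only [noninvCount_eq_sum]
  have hmix : (∑ a : Fin n₁, ∑ b : Fin n₂, if phi₁ h a < phi₂ h b ∧
        phi₁ h (σ₁ a) < phi₂ h (σ₂ b) then 1 else 0) +
      (∑ b : Fin n₂, ∑ a : Fin n₁, if phi₂ h b < phi₁ h a ∧
        phi₂ h (σ₂ b) < phi₁ h (σ₁ a) then 1 else 0) = n₂ * stayCount σ₁ := by
    rw [sum_comm (s := (univ : Finset (Fin n₂))), ← sum_add_distrib, stayCount, card_filter,
      mul_sum]
    refine sum_congr rfl fun a _ ↦ ?_
    simp only [phi₁_lt_phi₂_iff, phi₂_lt_phi₁_iff, sum_const, card_univ, Fintype.card_fin,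
      smul_eq_mul]
    rw [← mul_add]
    congr 1
    split_ifs <;> omega
  rw [← hmix, ← (phiEquiv h).sum_comp, Fintype.sum_sum_type]
  simp only [← (phiEquiv h).sum_comp, Fintype.sum_sum_type, phiEquiv_inl, phiEquiv_inr,
    iprod_phi₁, iprod_phi₂, (phi₁_strictMono h).lt_iff_lt, (phi₂_strictMono h).lt_iff_lt,
    sum_add_distrib]
  omega

end Product

/-! ### Elements in stair form -/

/-- The element in stair form of the composition with the single part `n`. -/
def stairCycle (n : ℕ) : Perm (Fin n) := (List.ofFn (stairSeq n)).formPerm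

theorem stairForm_single {n : ℕ} (hn : 0 < n) :
    stairForm (Composition.single n hn) = stairCycle n := by
  simp [stairForm, List.splitWrtComposition, List.splitWrtCompositionAux_cons,
    List.splitWrtCompositionAux, stairCycle, List.take_of_length_le]

theorem stairForm_firstComp {n : ℕ} (α : Composition n) (hl : 1 ≤ α.length) :
    stairForm (firstComp α hl) = stairCycle (firstPart α hl) :=
  stairForm_single _

/-- Relabelling the letters of a list changes the cycle it defines by the corresponding
homomorphism of symmetric groups, here given by its values on transpositions. -/
theorem formPerm_map {A B : Type*} [DecidableEq A] [DecidableEq B] (F : Perm A →* Perm B)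
    (g : A → B) (hF : ∀ a b, F (swap a b) = swap (g a) (g b)) (l : List A) :
    (l.map g).formPerm = F l.formPerm := by
  match l with
  | [] => simp
  | [a] => simp
  | a :: b :: l =>
    have := formPerm_map F g hF (b :: l)
    rw [List.map_cons] at this
    rw [List.map_cons, List.map_cons, List.formPerm_cons_cons, List.formPerm_cons_cons, this,
      map_mul, hF]

theorem prod_map_formPerm_splitWrtCompositionAux {A B : Type*} [DecidableEq A] [DecidableEq B]
    (F : Perm A →* Perm B) (g : A → B) (hF : ∀ a b, F (swap a b) = swap (g a) (g b)) (l : List A)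
    (ns : List ℕ) :
    (((l.map g).splitWrtCompositionAux ns).map List.formPerm).prod =
      F ((l.splitWrtCompositionAux ns).map List.formPerm).prod := by
  induction ns generalizing l with
  | nil => simp [List.splitWrtCompositionAux]
  | cons k ns ih =>
    simp only [List.splitWrtCompositionAux_cons, List.map_cons, List.prod_cons, map_mul,
      ← List.map_take, ← List.map_drop, ih, formPerm_map F g hF]

theorem stairSeq_val {n : ℕ} (p : Fin n) :
    (stairSeq n p : ℕ) = if (p : ℕ) % 2 = 0 then (p / 2 : ℕ) else n - 1 - p / 2 :=
  apply_ite _ _ _ _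

theorem stairSeq_eq_phi₁ {n₁ n₂ n : ℕ} (h : n₁ + n₂ = n) (p : Fin n₁) :
    stairSeq n ⟨p, by omega⟩ = phi₁ h (stairSeq n₁ p) := by
  simp only [stairSeq, phi₁, Fin.ext_iff]
  split_ifs <;> simp only [] at * <;> omega

theorem stairSeq_eq_phi₂ {n₁ n₂ n : ℕ} (h : n₁ + n₂ = n) (h₁ : Even n₁) (p : Fin n₂) :
    stairSeq n ⟨n₁ + p, by omega⟩ = phi₂ h (stairSeq n₂ p) := by
  obtain ⟨k, rfl⟩ := h₁
  simp only [stairSeq, phi₂, Fin.ext_iff]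
  split_ifs <;> simp only [] at * <;> omega

theorem stairSeq_eq_phi₂_rev {n₁ n₂ n : ℕ} (h : n₁ + n₂ = n) (h₁ : Odd n₁) (p : Fin n₂) :
    stairSeq n ⟨n₁ + p, by omega⟩ = phi₂ h (w₀ n₂ (stairSeq n₂ p)) := by
  obtain ⟨k, rfl⟩ := h₁
  simp only [stairSeq, phi₂, Fin.ext_iff, w₀_apply, Fin.val_rev]
  split_ifs <;> simp only [] at * <;> omega

theorem ofFn_stairSeq {n₁ n₂ n : ℕ} (h : n₁ + n₂ = n) (ρ : Fin n₂ → Fin n₂)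
    (hρ : ∀ p : Fin n₂, stairSeq n ⟨n₁ + p, by omega⟩ = phi₂ h (ρ (stairSeq n₂ p))) :
    List.ofFn (stairSeq n) = (List.ofFn (stairSeq n₁)).map (phi₁ h) ++
      (List.ofFn (stairSeq n₂)).map (phi₂ h ∘ ρ) := by
  refine List.ext_getElem (by simp [h]) fun i hi hi' ↦ ?_
  rw [List.getElem_append]
  split_ifs with hlt
  · rw [List.length_map, List.length_ofFn] at hlt
    simpa using stairSeq_eq_phi₁ h ⟨i, hlt⟩
  · rw [List.length_map, List.length_ofFn] at hlt
    rw [List.length_ofFn] at hi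
    have := hρ ⟨i - n₁, by omega⟩
    simp only [List.getElem_map, List.getElem_ofFn, List.length_map, List.length_ofFn,
      Function.comp_apply, ← this]
    congr 2
    omega

theorem stairForm_eq_iprod_aux {n : ℕ} (α : Composition n) (hl : 1 ≤ α.length)
    (ρ : Perm (Fin (restSize α)))
    (hρ : ∀ p : Fin (restSize α),
      stairSeq n ⟨firstPart α hl + p, by have := firstPart_add_restSize α hl; omega⟩ =
        phi₂ (firstPart_add_restSize α hl) (ρ (stairSeq _ p))) :
    stairForm α = iprod (firstPart_add_restSize α hl) (stairForm (firstComp α hl))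
      (ρ * stairForm (restComp α) * ρ⁻¹) := by
  have hne : α.blocks ≠ [] := List.length_pos_iff.mp hl
  have hb : α.blocks = firstPart α hl :: (restComp α).blocks := (List.cons_head_tail hne).symm
  have h := firstPart_add_restSize α hl
  let F₁ : Perm (Fin (firstPart α hl)) →* Perm (Fin n) :=
    MonoidHom.mk' (fun σ ↦ blockPerm (phiEquiv h) σ 1) fun σ τ ↦ by simp [blockPerm_mul]
  let F₂ : Perm (Fin (restSize α)) →* Perm (Fin n) :=
    MonoidHom.mk' (fun σ ↦ blockPerm (phiEquiv h) 1 (ρ * σ * ρ⁻¹)) fun σ τ ↦ by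
      simp [blockPerm_mul, mul_assoc]
  have hF₁ (a b) : F₁ (swap a b) = swap (phi₁ h a) (phi₁ h b) := blockPerm_swap_one _ a b
  have hF₂ (a b) : F₂ (swap a b) = swap ((phi₂ h ∘ ρ) a) ((phi₂ h ∘ ρ) b) := by
    refine Eq.trans ?_ (blockPerm_one_swap (phiEquiv h) (ρ a) (ρ b))
    rw [swap_apply_apply]
    rfl
  have hlen : ((List.ofFn (stairSeq (firstPart α hl))).map (phi₁ h)).length = firstPart α hl := by
    simp
  rw [stairForm, List.splitWrtComposition, hb, List.splitWrtCompositionAux_cons,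
    ofFn_stairSeq h ρ hρ, List.take_left' hlen, List.drop_left' hlen, List.map_cons,
    List.prod_cons, formPerm_map F₁ _ hF₁, prod_map_formPerm_splitWrtCompositionAux F₂ _ hF₂,
    stairForm_firstComp]
  change blockPerm (phiEquiv h) (stairCycle _) 1 *
    blockPerm (phiEquiv h) 1 (ρ * stairForm (restComp α) * ρ⁻¹) = _
  rw [blockPerm_mul, mul_one, one_mul, iprod_eq_blockPerm]

theorem stairForm_eq_iprod_of_even {n : ℕ} (α : Composition n) (hl : 1 ≤ α.length)
    (h₁ : Even (firstPart α hl)) :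
    stairForm α = iprod (firstPart_add_restSize α hl) (stairForm (firstComp α hl))
      (stairForm (restComp α)) := by
  simpa using stairForm_eq_iprod_aux α hl 1 fun p ↦ stairSeq_eq_phi₂ _ h₁ p

theorem stairForm_eq_iprod_of_odd {n : ℕ} (α : Composition n) (hl : 1 ≤ α.length)
    (h₁ : Odd (firstPart α hl)) :
    stairForm α = iprod (firstPart_add_restSize α hl) (stairForm (firstComp α hl))
      (w₀ _ * stairForm (restComp α) * (w₀ _)⁻¹) :=
  stairForm_eq_iprod_aux α hl (w₀ _) fun p ↦ stairSeq_eq_phi₂_rev _ h₁ p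

theorem stairSeq_injective (n : ℕ) : Function.Injective (stairSeq n) := by
  intro p q h
  simp only [stairSeq] at h
  split_ifs at h <;> simp only [Fin.ext_iff] at * <;> omega

theorem stairSeq_surjective (n : ℕ) : Function.Surjective (stairSeq n) :=
  Finite.surjective_of_injective (stairSeq_injective n)

theorem stairCycle_stairSeq {n : ℕ} (p : Fin n) :
    stairCycle n (stairSeq n p) =
      stairSeq n ⟨(p + 1) % n, Nat.mod_lt _ p.pos⟩ := by
  have := List.formPerm_apply_getElem (List.ofFn (stairSeq n))
    (List.nodup_ofFn.2 (stairSeq_injective n)) p (by simp)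
  simp only [List.getElem_ofFn, List.length_ofFn] at this
  exact this

theorem sameCycle_stairCycle {n : ℕ} (x y : Fin n) : (stairCycle n).SameCycle x y := by
  have := (List.nodup_ofFn.2 (stairSeq_injective n)).isCycleOn_formPerm
  have hmem (z : Fin n) : z ∈ {a | a ∈ List.ofFn (stairSeq n)} :=
    List.mem_ofFn.2 (stairSeq_surjective n z)
  exact this.2 (hmem x) (hmem y)

/-! ### The case of an even first part -/

theorem apply_inv_apply {n : ℕ} (σ : Perm (Fin n)) (x : Fin n) : σ (σ⁻¹ x) = x :=
  σ.apply_symm_apply x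

/-- The permutation `σ` exchanges the lower half and the upper half of the letters. -/
def SwapsHalves {k : ℕ} (σ : Perm (Fin (k + k))) : Prop :=
  ∀ x, (σ x : ℕ) < k ↔ k ≤ (x : ℕ)

theorem swapsHalves_stairCycle (k : ℕ) : SwapsHalves (stairCycle (k + k)) := by
  intro x
  obtain ⟨p, rfl⟩ := stairSeq_surjective _ x
  rw [stairCycle_stairSeq]
  have hp := p.2
  rw [stairSeq_val, stairSeq_val]
  by_cases h : (p : ℕ) + 1 = k + k
  · simp only [h, Nat.mod_self]
    split_ifs <;> omega
  · simp only [Nat.mod_eq_of_lt (show (p : ℕ) + 1 < k + k by omega)]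
    split_ifs <;> omega

/-- A permutation that exchanges the two halves has a descent on both sides at the two middle
letters. -/
theorem SwapsHalves.not_isBalancedAt {k : ℕ} {σ : Perm (Fin (k + k))} (hσ : SwapsHalves σ)
    {a b : Fin (k + k)} (hab : (a : ℕ) + 1 = b) (hb : (b : ℕ) = k) : ¬ IsBalancedAt σ a b := by
  have h₁ := hσ a
  have h₂ := hσ b
  have h₃ := hσ (σ⁻¹ a)
  have h₄ := hσ (σ⁻¹ b)
  simp only [apply_inv_apply] at h₃ h₄
  simp only [IsBalancedAt, Fin.lt_def]
  omega

theorem SwapsHalves.balancedStep {k : ℕ} {σ τ : Perm (Fin (k + k))} (hσ : SwapsHalves σ)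
    (h : BalancedStep σ τ) : SwapsHalves τ := by
  obtain ⟨a, b, hab, hbal, rfl⟩ := h
  have hb : (b : ℕ) ≠ k := fun hb ↦ hσ.not_isBalancedAt hab hb hbal
  have hs (x : Fin (k + k)) : (swap a b x : ℕ) < k ↔ (x : ℕ) < k := by
    rw [swap_apply_def]
    split_ifs <;> simp only [Fin.ext_iff] at * <;> omega
  intro x
  have h₁ := hs (σ (swap a b x))
  have h₂ := hσ (swap a b x)
  have h₃ := hs x
  simp only [Perm.mul_apply]
  omega

theorem Approx.swapsHalves {k : ℕ} {σ : Perm (Fin (k + k))}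
    (h : Approx (stairCycle (k + k)) σ) : SwapsHalves σ :=
  h.induction (swapsHalves_stairCycle k) fun _ _ hs hu ↦ hu.balancedStep hs

section Product

variable {n₁ n₂ n : ℕ} (h : n₁ + n₂ = n)

theorem strictMono_phiEquiv_inl : StrictMono (phiEquiv h ∘ .inl) := phi₁_strictMono h

theorem strictMono_phiEquiv_inr : StrictMono (phiEquiv h ∘ .inr) := phi₂_strictMono h

theorem phi₁_add_one {a b : Fin n₁} (hab : (a : ℕ) + 1 = b) (hb : (b : ℕ) ≠ (n₁ + 1) / 2) :
    (phi₁ h a : ℕ) + 1 = phi₁ h b := by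
  simp only [phi₁]
  split_ifs <;> simp only [] <;> omega

/-- Steps inside the outer block lift to the inductive product, except for the step at the place
where the inner block is inserted. -/
theorem BalancedStep.iprod_left {σ₁ : Perm (Fin n₁)} (σ₂ : Perm (Fin n₂)) {a b : Fin n₁}
    (hab : (a : ℕ) + 1 = b) (hb : (b : ℕ) ≠ (n₁ + 1) / 2) (hbal : IsBalancedAt σ₁ a b) :
    BalancedStep (iprod h σ₁ σ₂) (iprod h (swap a b * σ₁ * swap a b) σ₂) :=
  ⟨phi₁ h a, phi₁ h b, phi₁_add_one h hab hb,
    (balanced_blockPerm_inl σ₁ σ₂ (strictMono_phiEquiv_inl h)).2 hbal,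
    (swap_conj_blockPerm_inl (phiEquiv h) σ₁ σ₂ a b).symm⟩

/-- Steps inside the inner block lift to the inductive product. -/
theorem BalancedStep.iprod_right (σ₁ : Perm (Fin n₁)) {σ₂ τ₂ : Perm (Fin n₂)}
    (hs : BalancedStep σ₂ τ₂) : BalancedStep (iprod h σ₁ σ₂) (iprod h σ₁ τ₂) := by
  obtain ⟨a, b, hab, hbal, rfl⟩ := hs
  exact ⟨phi₂ h a, phi₂ h b, by simp only [phi₂]; omega,
    (balanced_blockPerm_inr σ₁ σ₂ (strictMono_phiEquiv_inr h)).2 hbal,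
    (swap_conj_blockPerm_inr (phiEquiv h) σ₁ σ₂ a b).symm⟩

theorem Approx.iprod_right (σ₁ : Perm (Fin n₁)) {σ₂ τ₂ : Perm (Fin n₂)}
    (hs : Approx σ₂ τ₂) : Approx (iprod h σ₁ σ₂) (iprod h σ₁ τ₂) :=
  hs.induction (p := fun τ ↦ Approx (iprod h σ₁ σ₂) (iprod h σ₁ τ)) (approx_refl _)
    fun _ _ hs hu ↦ approx_trans hu (hs.iprod_right h σ₁).approx

end Product

section Even

variable {k n₂ n : ℕ} (h : (k + k) + n₂ = n)

theorem Approx.iprod_left_of_even {σ₁ : Perm (Fin (k + k))} (σ₂ : Perm (Fin n₂))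
    (hs : Approx (stairCycle (k + k)) σ₁) :
    Approx (iprod h (stairCycle (k + k)) σ₂) (iprod h σ₁ σ₂) := by
  refine (hs.induction (p := fun τ ↦ SwapsHalves τ ∧
    Approx (iprod h (stairCycle (k + k)) σ₂) (iprod h τ σ₂))
    ⟨swapsHalves_stairCycle k, approx_refl _⟩ ?_).2
  rintro u v huv ⟨hu, hu'⟩
  refine ⟨hu.balancedStep huv, approx_trans hu' ?_⟩
  obtain ⟨a, b, hab, hbal, rfl⟩ := huv
  have hb : (b : ℕ) ≠ k := fun hb ↦ hu.not_isBalancedAt hab hb hbal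
  exact (BalancedStep.iprod_left h σ₂ hab (by omega) hbal).approx

/-- Every balanced step from an inductive product whose left factor exchanges the halves is a step
in one of the factors: at the two ends of the inner block there is a descent on both sides. -/
theorem BalancedStep.exists_of_iprod {σ₁ : Perm (Fin (k + k))} (hσ : SwapsHalves σ₁)
    {σ₂ : Perm (Fin n₂)} {τ : Perm (Fin n)} (hs : BalancedStep (iprod h σ₁ σ₂) τ) :
    (∃ τ₁, BalancedStep σ₁ τ₁ ∧ τ = iprod h τ₁ σ₂) ∨
      ∃ τ₂, BalancedStep σ₂ τ₂ ∧ τ = iprod h σ₁ τ₂ := by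
  obtain ⟨i, j, hij, hbal, rfl⟩ := hs
  rw [iprod_eq_blockPerm] at hbal ⊢
  obtain ⟨a | a, rfl⟩ := (phiEquiv h).surjective i <;>
    obtain ⟨b | b, rfl⟩ := (phiEquiv h).surjective j
  · rw [balanced_blockPerm_inl _ _ (strictMono_phiEquiv_inl h)] at hbal
    refine .inl ⟨_, ⟨a, b, ?_, hbal, rfl⟩, swap_conj_blockPerm_inl _ _ _ _ _⟩
    simp only [phiEquiv_inl, phi₁] at hij
    split_ifs at hij <;> simp only [] at hij <;> omega
  · exfalso
    simp only [IsBalancedAt, blockPerm_inv, blockPerm_inl, blockPerm_inr] at hbal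
    simp only [phiEquiv_inl, phiEquiv_inr, phi₁_lt_phi₂_iff, phi₂_lt_phi₁_iff] at hbal
    have h₁ := hσ a
    have h₂ := hσ (σ₁⁻¹ a)
    have ha : (a : ℕ) < k := by
      have : phi₁ h a < phi₂ h b := by rw [Fin.lt_def]; exact hij ▸ Nat.lt_succ_self _
      have := (phi₁_lt_phi₂_iff h).1 this
      omega
    simp only [apply_inv_apply] at h₂
    omega
  · exfalso
    simp only [IsBalancedAt, blockPerm_inv, blockPerm_inl, blockPerm_inr] at hbal
    simp only [phiEquiv_inl, phiEquiv_inr, phi₁_lt_phi₂_iff, phi₂_lt_phi₁_iff] at hbal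
    have h₁ := hσ b
    have h₂ := hσ (σ₁⁻¹ b)
    have hb : k ≤ (b : ℕ) := by
      have : phi₂ h a < phi₁ h b := by rw [Fin.lt_def]; exact hij ▸ Nat.lt_succ_self _
      have := (phi₂_lt_phi₁_iff h).1 this
      omega
    simp only [apply_inv_apply] at h₂
    omega
  · rw [balanced_blockPerm_inr _ _ (strictMono_phiEquiv_inr h)] at hbal
    refine .inr ⟨_, ⟨a, b, ?_, hbal, rfl⟩, swap_conj_blockPerm_inr _ _ _ _ _⟩
    simp only [phiEquiv_inr, phi₂] at hij
    omega

theorem Approx.exists_of_iprod {σ₂ : Perm (Fin n₂)} {τ : Perm (Fin n)}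
    (hs : Approx (iprod h (stairCycle (k + k)) σ₂) τ) :
    ∃ τ₁ τ₂, Approx (stairCycle (k + k)) τ₁ ∧ Approx σ₂ τ₂ ∧ iprod h τ₁ τ₂ = τ := by
  refine hs.induction (p := fun τ ↦ ∃ τ₁ τ₂, Approx (stairCycle (k + k)) τ₁ ∧ Approx σ₂ τ₂ ∧
    iprod h τ₁ τ₂ = τ) ⟨_, _, approx_refl _, approx_refl _, rfl⟩ ?_
  rintro _ v huv ⟨τ₁, τ₂, h₁, h₂, rfl⟩
  rcases huv.exists_of_iprod h h₁.swapsHalves with ⟨τ, hτ, rfl⟩ | ⟨τ, hτ, rfl⟩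
  · exact ⟨τ, τ₂, approx_trans h₁ hτ.approx, h₂, rfl⟩
  · exact ⟨τ₁, τ, h₁, approx_trans h₂ hτ.approx, rfl⟩

end Even

theorem sigmaClass_eq_iprodSet {n : ℕ} (α : Composition n) (hl : 1 ≤ α.length)
    (h₁ : Even (firstPart α hl)) :
    SigmaClass α = iprodSet (firstPart_add_restSize α hl) (SigmaClass (firstComp α hl))
      (SigmaClass (restComp α)) := by
  ext σ
  simp only [SigmaClass, iprodSet, Set.mem_ofPred_eq, stairForm_eq_iprod_of_even α hl h₁,
    stairForm_firstComp]
  generalize stairForm (restComp α) = σ₂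
  generalize firstPart_add_restSize α hl = h
  generalize firstPart α hl = n₁ at h h₁
  obtain ⟨k, rfl⟩ := h₁
  constructor
  · intro hs
    obtain ⟨τ₁, τ₂, h₁, h₂, rfl⟩ := hs.exists_of_iprod h
    exact ⟨τ₁, h₁, τ₂, h₂, rfl⟩
  · rintro ⟨τ₁, h₁, τ₂, h₂, rfl⟩
    exact approx_trans (h₁.iprod_left_of_even h σ₂) (h₂.iprod_right h τ₁)

/-! ### Twisted Coxeter words -/

/-- A letter `(j, b)` stands for one of the two generators `s_j` and `s_{n - 2 - j}` which are
interchanged by conjugation with the longest element, according to the sign `b`. -/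
abbrev Letter := ℕ × Bool

/-- The letter for the conjugate of the generator by the longest element. -/
def Letter.flip (x : Letter) : Letter := (x.1, !x.2)

theorem Letter.flip_flip (x : Letter) : x.flip.flip = x := by
  simp [Letter.flip]

/-- The two letters stand for commuting generators: their labels are not adjacent, or they are
adjacent but the generators are in different halves. -/
def Letter.Commutes (x y : Letter) : Prop :=
  x.1 + 2 ≤ y.1 ∨ y.1 + 2 ≤ x.1 ∨ (x.1 + 1 = y.1 ∨ y.1 + 1 = x.1) ∧ x.2 ≠ y.2

theorem Letter.Commutes.symm {x y : Letter} (h : x.Commutes y) : y.Commutes x := by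
  simp only [Letter.Commutes, ne_eq, eq_comm (a := y.2)] at *
  tauto

/-- An elementary transformation of words: exchange of neighbouring commuting letters, or a cyclic
shift that flips the letter moved from one end to the other. -/
inductive WordStep : List Letter → List Letter → Prop
  | comm (A : List Letter) {x y : Letter} (B : List Letter) (h : x.Commutes y) :
      WordStep (A ++ x :: y :: B) (A ++ y :: x :: B)
  | shift (x : Letter) (A : List Letter) : WordStep (x :: A) (A ++ [x.flip])
  | unshift (x : Letter) (A : List Letter) : WordStep (A ++ [x]) (x.flip :: A)

/-- Equivalence of words under elementary transformations. -/
def WordEquiv : List Letter → List Letter → Prop := Relation.ReflTransGen WordStep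

theorem WordStep.symm {K L : List Letter} (h : WordStep K L) : WordStep L K := by
  cases h with
  | comm A B h => exact .comm A B h.symm
  | shift x A => simpa only [Letter.flip_flip] using WordStep.unshift x.flip A
  | unshift x A => simpa only [Letter.flip_flip] using WordStep.shift x.flip A

theorem WordEquiv.symm {K L : List Letter} (h : WordEquiv K L) : WordEquiv L K :=
  have : Std.Symm WordStep := ⟨fun _ _ ↦ WordStep.symm⟩
  (Relation.ReflTransGen.stdSymm (r := WordStep)).symm _ _ h

theorem WordStep.labels_perm {K L : List Letter} (h : WordStep K L) :
    (K.map Prod.fst).Perm (L.map Prod.fst) := by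
  cases h with
  | comm A B h =>
    simp only [List.map_append, List.map_cons]
    exact (List.Perm.swap _ _ _).append_left _
  | shift x A =>
    simp only [List.map_append, List.map_cons, List.map_nil, Letter.flip]
    exact (List.perm_append_singleton _ _).symm
  | unshift x A =>
    simp only [List.map_append, List.map_cons, List.map_nil, Letter.flip]
    exact List.perm_append_singleton _ _

/-- A letter whose label exceeds all labels of a word by at least two commutes past the word. -/
theorem wordEquiv_move {z : Letter} (C A B : List Letter) (hA : ∀ x ∈ A, x.1 + 2 ≤ z.1) :
    WordEquiv (C ++ z :: (A ++ B)) (C ++ A ++ z :: B) := by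
  induction A generalizing C with
  | nil => simpa using .refl
  | cons x A ih =>
    have h₁ : WordStep (C ++ z :: x :: (A ++ B)) (C ++ x :: z :: (A ++ B)) :=
      .comm _ _ (.inr (.inl (hA x (by simp))))
    have h₂ := ih (C ++ [x]) fun y hy ↦ hA y (by simp [hy])
    simp only [List.append_assoc, List.cons_append, List.nil_append] at h₂ ⊢
    exact .head h₁ h₂

/-- A letter with a new largest label `m` can be carried along when a word in the smaller labels
is transformed. -/
theorem WordStep.exists_insert {m : ℕ} {L L' : List Letter} (h : WordStep L L')
    (hL : ∀ x ∈ L, x.1 < m) {A B : List Letter} (hAB : A ++ B = L) (b : Bool) :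
    ∃ A' B' b', A' ++ B' = L' ∧ WordEquiv (A ++ (m, b) :: B) (A' ++ (m, b') :: B') := by
  cases h with
  | @comm C x y D hxy =>
    rcases List.append_eq_append_iff.1 hAB with ⟨a, rfl, rfl⟩ | ⟨c, rfl, hc⟩
    · refine ⟨A, a ++ y :: x :: D, b, by simp, .single ?_⟩
      simpa using WordStep.comm (A ++ (m, b) :: a) D hxy
    match c, hc with
    | [], hc =>
      obtain rfl : x :: y :: D = B := hc
      refine ⟨C, y :: x :: D, b, by simp, .single ?_⟩
      simpa using WordStep.comm (C ++ [(m, b)]) D hxy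
    | [x'], hc =>
      obtain ⟨rfl, rfl⟩ : x = x' ∧ y :: D = B := by simpa using hc
      have hx : x.1 < m := hL x (by simp)
      have hy : y.1 < m := hL y (by simp)
      -- Only the label `m - 1` is adjacent to `m`, and it is not carried by both `x` and `y`.
      have : y.1 + 2 ≤ m ∨ x.1 + 2 ≤ m := by
        simp only [Letter.Commutes] at hxy
        omega
      rcases this with h | h
      · refine ⟨C ++ [y, x], D, b, by simp, .head (b := C ++ x :: y :: (m, b) :: D) ?_ (.single ?_)⟩
        · simpa using WordStep.comm (C ++ [x]) D (x := (m, b)) (y := y) (.inr (.inl h))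
        · simpa using WordStep.comm C ((m, b) :: D) hxy
      · refine ⟨C, y :: x :: D, b, by simp, .head (b := C ++ (m, b) :: x :: y :: D) ?_ (.single ?_)⟩
        · simpa using WordStep.comm C (y :: D) (x := x) (y := (m, b)) (.inl h)
        · simpa using WordStep.comm (C ++ [(m, b)]) D hxy
    | x' :: y' :: c, hc =>
      obtain ⟨rfl, rfl, rfl⟩ : x = x' ∧ y = y' ∧ D = c ++ B := by simpa using hc
      refine ⟨C ++ y :: x :: c, B, b, by simp, .single ?_⟩
      simpa using WordStep.comm C (c ++ (m, b) :: B) hxy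
  | shift x M =>
    match A, hAB with
    | [], hB =>
      obtain rfl : B = x :: M := hB
      refine ⟨M, [x.flip], !b, by simp, .head (b := x :: M ++ [(m, !b)]) ?_ (.single ?_)⟩
      · exact WordStep.shift (m, b) (x :: M)
      · simpa using WordStep.shift x (M ++ [(m, !b)])
    | x' :: A, hAB =>
      obtain ⟨rfl, rfl⟩ : x' = x ∧ A ++ B = M := by simpa using hAB
      refine ⟨A, B ++ [x'.flip], b, by simp, .single ?_⟩
      simpa using WordStep.shift x' (A ++ (m, b) :: B)
  | unshift x M =>
    rcases List.eq_nil_or_concat B with rfl | ⟨B, x', rfl⟩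
    · obtain rfl : A = M ++ [x] := by simpa using hAB
      refine ⟨[x.flip], M, !b, by simp, .head (b := (m, !b) :: M ++ [x]) ?_ (.single ?_)⟩
      · simpa [Letter.flip] using WordStep.unshift (m, b) (M ++ [x])
      · simpa using WordStep.unshift x ((m, !b) :: M)
    · obtain ⟨rfl, rfl⟩ : A ++ B = M ∧ x' = x := by
        rw [List.concat_eq_append, ← List.append_assoc] at hAB
        simpa using List.append_inj' hAB rfl
      refine ⟨x'.flip :: A, B, b, by simp, .single ?_⟩
      simpa using WordStep.unshift x' (A ++ (m, b) :: B)

theorem WordEquiv.exists_insert {m : ℕ} {L L' : List Letter} (h : WordEquiv L L')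
    (hL : ∀ x ∈ L, x.1 < m) {A B : List Letter} (hAB : A ++ B = L) (b : Bool) :
    ∃ A' B' b', A' ++ B' = L' ∧ WordEquiv (A ++ (m, b) :: B) (A' ++ (m, b') :: B') := by
  suffices (∀ x ∈ L', x.1 < m) ∧
      ∃ A' B' b', A' ++ B' = L' ∧ WordEquiv (A ++ (m, b) :: B) (A' ++ (m, b') :: B') from this.2
  induction h with
  | refl => exact ⟨hL, A, B, b, hAB, .refl⟩
  | tail _ hs ih =>
    obtain ⟨hM, A', B', b', hAB', he⟩ := ih
    obtain ⟨A'', B'', b'', h, he'⟩ := hs.exists_insert hM hAB' b'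
    refine ⟨fun x hx ↦ ?_, A'', B'', b'', h, he.trans he'⟩
    obtain ⟨y, hy, hxy⟩ := List.mem_map.1
      (hs.labels_perm.mem_iff.2 (List.mem_map_of_mem (f := Prod.fst) hx))
    exact hxy ▸ hM y hy

/-- The word `s_{m - 1} ⋯ s_1 s_0`. -/
def canonicalWord : ℕ → List Letter
  | 0 => []
  | m + 1 => (m, true) :: canonicalWord m

theorem label_lt_of_mem_canonicalWord {m : ℕ} {x : Letter} (hx : x ∈ canonicalWord m) :
    x.1 < m := by
  induction m with
  | zero => simp [canonicalWord] at hx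
  | succ m ih =>
    rcases List.mem_cons.1 hx with rfl | hx
    · exact Nat.lt_succ_self m
    · exact (ih hx).trans (Nat.lt_succ_self m)

/-- All words that contain each of the labels `0, …, m - 1` exactly once are equivalent. The letter
with the largest label only has to be moved relative to the letter with the next label. Shifting
it past the ends of the word changes its side and its sign, and it changes sides freely when the
two signs differ. -/
theorem wordEquiv_canonicalWord {m : ℕ} {K : List Letter}
    (hK : (K.map Prod.fst).Perm (List.range m)) : WordEquiv K (canonicalWord m) := by
  induction m generalizing K with
  | zero =>
    obtain rfl : K = [] := by simpa using hK
    exact .refl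
  | succ m ih =>
    have hm : m ∈ K.map Prod.fst := hK.mem_iff.2 (by simp)
    obtain ⟨⟨m', b⟩, hz, rfl⟩ := List.mem_map.1 hm
    obtain ⟨A, B, rfl⟩ := List.append_of_mem hz
    dsimp only at *
    have hAB : ((A ++ B).map Prod.fst).Perm (List.range m') := by
      refine List.Perm.cons_inv (a := m') ?_
      rw [List.range_succ] at hK
      refine List.Perm.trans ?_ (hK.trans (List.perm_append_singleton _ _))
      simpa using (List.perm_middle (l₁ := A.map Prod.fst) (a := m') (l₂ := B.map Prod.fst)).symm
    have hlt : ∀ x ∈ A ++ B, x.1 < m' := fun x hx ↦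
      List.mem_range.1 (hAB.mem_iff.1 (List.mem_map_of_mem (f := Prod.fst) hx))
    obtain ⟨A', B', b', hc, he⟩ := (ih hAB).exists_insert hlt rfl b
    refine he.trans ?_
    clear he hK hz hm hAB hlt ih
    cases m' with
    | zero =>
      obtain ⟨rfl, rfl⟩ : A' = [] ∧ B' = [] := by simpa [canonicalWord] using hc
      cases b'
      · exact .single (.shift _ _)
      · exact .refl
    | succ k =>
      have hlast (b : Bool) : WordEquiv ((k, true) :: (k + 1, b) :: canonicalWord k)
          ((k + 1, !b) :: (k, true) :: canonicalWord k) := by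
        have h₁ := wordEquiv_move (z := (k + 1, b)) [(k, true)] (canonicalWord k) [] fun x hx ↦ by
          have := label_lt_of_mem_canonicalWord hx
          simp only
          omega
        rw [List.append_nil] at h₁
        exact h₁.trans (.single (.unshift (k + 1, b) ((k, true) :: canonicalWord k)))
      have hleft : ∀ b, WordEquiv ((k + 1, b) :: (k, true) :: canonicalWord k)
          (canonicalWord (k + 2)) := by
        rintro (_ | _)
        · refine .trans (.single ?_) (hlast false)
          exact WordStep.comm [] _ (.inr (.inr ⟨.inr rfl, by simp⟩))
        · exact .refl
      match A', hc with
      | [], hc =>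
        obtain rfl : B' = (k, true) :: canonicalWord k := hc
        exact hleft b'
      | x :: A', hc =>
        obtain ⟨rfl, hc'⟩ : x = (k, true) ∧ A' ++ B' = canonicalWord k := by
          simpa [canonicalWord] using hc
        have h₁ := wordEquiv_move (z := (k + 1, b')) [(k, true)] A' B' fun x hx ↦ by
          have := label_lt_of_mem_canonicalWord (m := k) (x := x) (hc' ▸ by simp [hx])
          simp only
          omega
        rw [hc'] at h₁
        exact h₁.symm.trans ((hlast b').trans (hleft _))

/-! ### Longest full cycles on an odd number of letters -/

/-- The transposition of the letters `i` and `i + 1`, or `1` if these are out of range. -/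
def adj (n i : ℕ) : Perm (Fin n) :=
  if h : i + 1 < n then swap ⟨i, by omega⟩ ⟨i + 1, h⟩ else 1

theorem adj_mem_adjacentTranspositions {n i : ℕ} (hi : i + 1 < n) :
    adj n i ∈ adjacentTranspositions n :=
  ⟨⟨i, by omega⟩, ⟨i + 1, hi⟩, rfl, by rw [adj, dif_pos hi]⟩

theorem adj_mul_self (n i : ℕ) : adj n i * adj n i = 1 := by
  unfold adj
  split_ifs
  · exact swap_mul_self _ _
  · exact one_mul 1

theorem adj_lt_iff {n i c : ℕ} (hc : i + 1 ≠ c) (x : Fin n) :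
    (adj n i x : ℕ) < c ↔ (x : ℕ) < c := by
  unfold adj
  split_ifs
  · rw [swap_apply_def]
    split_ifs <;> simp only [Fin.ext_iff] at * <;> omega
  · rfl

theorem adj_mul_adj_comm {n i j : ℕ} (h : i + 2 ≤ j ∨ j + 2 ≤ i) :
    adj n i * adj n j = adj n j * adj n i := by
  by_cases hi : i + 1 < n
  · by_cases hj : j + 1 < n
    · simp only [adj, dif_pos hi, dif_pos hj]
      rw [mul_swap_eq_swap_mul, swap_apply_of_ne_of_ne, swap_apply_of_ne_of_ne] <;>
        simp only [ne_eq, Fin.mk.injEq] <;> omega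
    · simp [adj, hj]
  · simp [adj, hi]

theorem w₀_conj_adj {n i j : ℕ} (hij : i + j + 2 = n) :
    w₀ n * adj n i * w₀ n = adj n j := by
  have hi : i + 1 < n := by omega
  have hj : j + 1 < n := by omega
  simp only [adj, dif_pos hi, dif_pos hj]
  have := swap_apply_apply (w₀ n) ⟨i, by omega⟩ ⟨i + 1, hi⟩
  rw [w₀_inv] at this
  rw [← this, swap_comm]
  congr 1 <;> simp only [w₀_apply, Fin.ext_iff, Fin.val_rev] <;> omega

/-- The generator for a letter in the symmetric group on `2 * h + 1` letters. -/
def letterPerm (h : ℕ) (x : Letter) : Perm (Fin (2 * h + 1)) :=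
  if x.2 then adj _ x.1 else adj _ (2 * h - 1 - x.1)

theorem letterPerm_eq_adj (h : ℕ) (x : Letter) :
    letterPerm h x = adj _ (if x.2 then x.1 else 2 * h - 1 - x.1) := by
  unfold letterPerm
  split_ifs <;> rfl

theorem exists_letterPerm {h : ℕ} {t : Perm (Fin (2 * h + 1))}
    (ht : t ∈ adjacentTranspositions (2 * h + 1)) : ∃ x : Letter, x.1 < h ∧ letterPerm h x = t := by
  obtain ⟨i, j, hij, rfl⟩ := ht
  have hj := j.2
  have : swap i j = adj _ (i : ℕ) := by
    rw [adj, dif_pos (by omega)]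
    congr 1
    exact Fin.ext hij.symm
  rw [this]
  by_cases hi : (i : ℕ) < h
  · exact ⟨(i, true), hi, rfl⟩
  · refine ⟨(2 * h - 1 - i, false), by dsimp only; omega, ?_⟩
    rw [letterPerm_eq_adj]
    congr 1
    simp only [Bool.false_eq_true, if_false]
    omega

theorem letterPerm_mem_adjacentTranspositions {h : ℕ} {x : Letter} (hx : x.1 < h) :
    letterPerm h x ∈ adjacentTranspositions (2 * h + 1) := by
  rw [letterPerm_eq_adj]
  apply adj_mem_adjacentTranspositions
  split_ifs <;> omega

theorem letterPerm_mul_self (h : ℕ) (x : Letter) : letterPerm h x * letterPerm h x = 1 := by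
  rw [letterPerm_eq_adj, adj_mul_self]

theorem letterPerm_flip {h : ℕ} {x : Letter} (hx : x.1 < h) :
    letterPerm h x.flip = w₀ _ * letterPerm h x * w₀ _ := by
  rw [letterPerm_eq_adj, letterPerm_eq_adj, w₀_conj_adj]
  obtain ⟨j, b⟩ := x
  cases b <;> simp [Letter.flip] <;> omega

theorem letterPerm_mul_comm {h : ℕ} {x y : Letter} (hx : x.1 < h) (hy : y.1 < h)
    (hxy : x.Commutes y) :
    letterPerm h x * letterPerm h y = letterPerm h y * letterPerm h x := by
  rw [letterPerm_eq_adj, letterPerm_eq_adj]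
  apply adj_mul_adj_comm
  obtain ⟨i, b⟩ := x
  obtain ⟨j, c⟩ := y
  cases b <;> cases c <;> simp [Letter.Commutes] at * <;> omega

/-- The permutation `t₁ ⋯ t_r w₀` for a word in the generators. -/
def wordPerm (h : ℕ) (K : List Letter) : Perm (Fin (2 * h + 1)) :=
  (K.map (letterPerm h)).prod * w₀ _

/-- All letters lie in one orbit of `σ`. -/
def IsFullCycle {n : ℕ} (σ : Perm (Fin n)) : Prop := ∀ x y, σ.SameCycle x y

theorem IsFullCycle.conj {n : ℕ} {σ : Perm (Fin n)} (hσ : IsFullCycle σ) (τ : Perm (Fin n)) :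
    IsFullCycle (τ * σ * τ⁻¹) :=
  fun _ _ ↦ Perm.sameCycle_conj.2 (hσ _ _)

theorem IsFullCycle.forall_of_invariant {n : ℕ} {σ : Perm (Fin n)} (hσ : IsFullCycle σ)
    {p : Fin n → Prop} (hp : ∀ x, p (σ x) ↔ p x) (x y : Fin n) (hx : p x) : p y := by
  obtain ⟨i, rfl⟩ := (hσ x y).exists_nat_pow_eq
  clear hσ
  induction i with
  | zero => exact hx
  | succ i ih =>
    rw [pow_succ', Perm.mul_apply, hp]
    exact ih

theorem prod_lt_iff {h c : ℕ} {K : List Letter}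
    (hK : ∀ x ∈ K, (if x.2 then x.1 else 2 * h - 1 - x.1) + 1 ≠ c) (v : Fin (2 * h + 1)) :
    ((K.map (letterPerm h)).prod v : ℕ) < c ↔ (v : ℕ) < c := by
  induction K with
  | nil => rfl
  | cons x K ih =>
    rw [List.map_cons, List.prod_cons, Perm.mul_apply, letterPerm_eq_adj,
      adj_lt_iff (hK x (by simp)), ih fun y hy ↦ hK y (by simp [hy])]

theorem wordPerm_lt_iff {h c : ℕ} {K : List Letter}
    (hK : ∀ x ∈ K, (if x.2 then x.1 else 2 * h - 1 - x.1) + 1 ≠ c) (v : Fin (2 * h + 1)) :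
    (wordPerm h K v : ℕ) < c ↔ 2 * h < c + v := by
  rw [wordPerm, Perm.mul_apply, prod_lt_iff hK, w₀_apply, Fin.val_rev]
  omega

/-- A word for a full cycle contains every label: without the label `j`, the first `j + 1` and the
last `j + 1` letters would together form an invariant set. -/
theorem IsFullCycle.mem_labels {h : ℕ} {K : List Letter} (hK : ∀ x ∈ K, x.1 < h)
    (hf : IsFullCycle (wordPerm h K)) {j : ℕ} (hj : j < h) : j ∈ K.map Prod.fst := by
  by_contra hmem
  have hne : ∀ x ∈ K, x.1 ≠ j := fun x hx hxj ↦ hmem (hxj ▸ List.mem_map_of_mem hx)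
  have h₁ := wordPerm_lt_iff (h := h) (c := j + 1) (K := K) fun x hx ↦ by
    have := hne x hx
    have := hK x hx
    split_ifs <;> omega
  have h₂ := wordPerm_lt_iff (h := h) (c := 2 * h - j) (K := K) fun x hx ↦ by
    have := hne x hx
    have := hK x hx
    split_ifs <;> omega
  have := hf.forall_of_invariant (p := fun v ↦ (v : ℕ) < j + 1 ∨ ¬ (v : ℕ) < 2 * h - j)
    (fun v ↦ by have := h₁ v; have := h₂ v; omega) ⟨0, by omega⟩ ⟨h, by omega⟩ (by simp)
  simp only at this
  omega

theorem exists_wordPerm_eq {h : ℕ} (σ : Perm (Fin (2 * h + 1))) :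
    ∃ K : List Letter, (∀ x ∈ K, x.1 < h) ∧ wordPerm h K = σ ∧ K.length = noninvCount σ := by
  obtain ⟨L, ⟨hL, hp⟩, hlen⟩ := exists_isWord_length_eq_invCount (σ * w₀ _)
  rw [invCount_mul_w₀] at hlen
  have : ∃ K : List Letter, (∀ x ∈ K, x.1 < h) ∧ K.map (letterPerm h) = L := by
    clear hp hlen
    induction L with
    | nil => exact ⟨[], by simp, rfl⟩
    | cons t L ih =>
      obtain ⟨K, hK, rfl⟩ := ih fun s hs ↦ hL s (by simp [hs])
      obtain ⟨x, hx, rfl⟩ := exists_letterPerm (hL t (by simp))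
      exact ⟨x :: K, List.forall_mem_cons.2 ⟨hx, hK⟩, rfl⟩
  obtain ⟨K, hK, rfl⟩ := this
  refine ⟨K, hK, ?_, by simpa using hlen⟩
  rw [wordPerm, hp, mul_assoc, w₀_mul_self, mul_one]

theorem range_subperm_of_isFullCycle {h : ℕ} {K : List Letter} (hK : ∀ x ∈ K, x.1 < h)
    (hf : IsFullCycle (wordPerm h K)) : (List.range h).Subperm (K.map Prod.fst) :=
  List.subperm_of_subset List.nodup_range fun _ hj ↦ hf.mem_labels hK (List.mem_range.1 hj)

theorem IsFullCycle.le_noninvCount {h : ℕ} {σ : Perm (Fin (2 * h + 1))} (hσ : IsFullCycle σ) :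
    h ≤ noninvCount σ := by
  obtain ⟨K, hK, rfl, hlen⟩ := exists_wordPerm_eq σ
  simpa [hlen] using (range_subperm_of_isFullCycle hK hσ).length_le

/-- A full cycle of maximal length is the product of `w₀` and a word that contains exactly one
generator out of each pair of generators interchanged by `w₀`. -/
theorem IsFullCycle.exists_word {h : ℕ} {σ : Perm (Fin (2 * h + 1))} (hσ : IsFullCycle σ)
    (hn : noninvCount σ = h) :
    ∃ K : List Letter, (K.map Prod.fst).Perm (List.range h) ∧ wordPerm h K = σ := by
  obtain ⟨K, hK, rfl, hlen⟩ := exists_wordPerm_eq σ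
  exact ⟨K, ((range_subperm_of_isFullCycle hK hσ).perm_of_length_le
    (by simp [hlen, hn])).symm, rfl⟩

theorem noninvCount_wordPerm_le {h : ℕ} {K : List Letter} (hK : ∀ x ∈ K, x.1 < h) :
    noninvCount (wordPerm h K) ≤ K.length := by
  rw [← invCount_mul_w₀, wordPerm, mul_assoc, w₀_mul_self, mul_one]
  have := invCount_le_length (L := K.map (letterPerm h)) ⟨?_, rfl⟩
  · simpa using this
  · intro s hs
    obtain ⟨x, hx, rfl⟩ := List.mem_map.1 hs
    exact letterPerm_mem_adjacentTranspositions (hK x hx)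

theorem wordPerm_shift {h : ℕ} {x : Letter} (hx : x.1 < h) (A : List Letter) :
    wordPerm h (A ++ [x.flip]) = letterPerm h x * wordPerm h (x :: A) * letterPerm h x := by
  have h₁ := letterPerm_mul_self h x
  simp only [wordPerm, List.map_append, List.map_cons, List.map_nil, List.prod_append,
    List.prod_cons, List.prod_nil, letterPerm_flip hx, mul_one]
  simp only [mul_assoc, w₀_mul_self, mul_one]
  rw [← mul_assoc (letterPerm h x), h₁, one_mul]

theorem labels_lt {h : ℕ} {K : List Letter} (hK : (K.map Prod.fst).Perm (List.range h)) :
    ∀ x ∈ K, x.1 < h :=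
  fun _ hx ↦ List.mem_range.1 (hK.mem_iff.1 (List.mem_map_of_mem hx))

theorem IsFullCycle.noninvCount_wordPerm {h : ℕ} {K : List Letter}
    (hK : (K.map Prod.fst).Perm (List.range h)) (hf : IsFullCycle (wordPerm h K)) :
    noninvCount (wordPerm h K) = h :=
  le_antisymm ((noninvCount_wordPerm_le (labels_lt hK)).trans_eq (by simpa using hK.length_eq))
    hf.le_noninvCount

theorem IsFullCycle.approx_shift {h : ℕ} {x : Letter} {A : List Letter}
    (hK : ((x :: A).map Prod.fst).Perm (List.range h)) (hf : IsFullCycle (wordPerm h (x :: A))) :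
    IsFullCycle (wordPerm h (A ++ [x.flip])) ∧
      Approx (wordPerm h (x :: A)) (wordPerm h (A ++ [x.flip])) := by
  have hx : x.1 < h := labels_lt hK x (by simp)
  have hconj := wordPerm_shift hx A
  have hf' : IsFullCycle (wordPerm h (A ++ [x.flip])) := by
    have := hf.conj (letterPerm h x)
    rwa [inv_eq_of_mul_eq_one_left (letterPerm_mul_self h x), ← hconj] at this
  have h₁ := hf.noninvCount_wordPerm hK
  have h₂ := hf'.noninvCount_wordPerm ((WordStep.shift x A).labels_perm.symm.trans hK)
  refine ⟨hf', ?_⟩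
  rw [hconj] at h₂ ⊢
  exact approx_of_invCount_eq (letterPerm_mem_adjacentTranspositions hx)
    (noninvCount_eq_iff.1 (h₂.trans h₁.symm))

theorem WordStep.approx {h : ℕ} {K L : List Letter} (hs : WordStep K L)
    (hK : (K.map Prod.fst).Perm (List.range h)) (hf : IsFullCycle (wordPerm h K)) :
    IsFullCycle (wordPerm h L) ∧ Approx (wordPerm h K) (wordPerm h L) := by
  cases hs with
  | @comm A x y B hxy =>
    have hx := labels_lt hK x (by simp)
    have hy := labels_lt hK y (by simp)
    have : wordPerm h (A ++ x :: y :: B) = wordPerm h (A ++ y :: x :: B) := by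
      simp only [wordPerm, List.map_append, List.map_cons, List.prod_append, List.prod_cons]
      rw [← mul_assoc (letterPerm h x), letterPerm_mul_comm hx hy hxy, mul_assoc (letterPerm h y)]
    rw [← this]
    exact ⟨hf, approx_refl _⟩
  | shift x A => exact hf.approx_shift hK
  | unshift x A =>
    have hx : x.flip.1 < h := labels_lt hK x (by simp)
    have hconj := wordPerm_shift hx A
    rw [Letter.flip_flip] at hconj
    have hf' : IsFullCycle (wordPerm h (x.flip :: A)) := by
      have := hf.conj (letterPerm h x.flip)
      rw [hconj, inv_eq_of_mul_eq_one_left (letterPerm_mul_self h x.flip)] at this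
      simpa only [mul_assoc, letterPerm_mul_self, mul_one,
        ← mul_assoc (letterPerm h x.flip) (letterPerm h x.flip), one_mul] using this
    have := hf'.approx_shift ((WordStep.unshift x A).labels_perm.symm.trans hK)
    rw [Letter.flip_flip] at this
    exact ⟨hf', approx_symm this.2⟩

theorem WordEquiv.approx {h : ℕ} {K L : List Letter} (hs : WordEquiv K L)
    (hK : (K.map Prod.fst).Perm (List.range h)) (hf : IsFullCycle (wordPerm h K)) :
    Approx (wordPerm h K) (wordPerm h L) := by
  suffices (L.map Prod.fst).Perm (List.range h) ∧ IsFullCycle (wordPerm h L) ∧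
    Approx (wordPerm h K) (wordPerm h L) from this.2.2
  induction hs with
  | refl => exact ⟨hK, hf, approx_refl _⟩
  | tail _ hs ih =>
    obtain ⟨hM, hfM, ha⟩ := ih
    obtain ⟨hf', ha'⟩ := hs.approx hM hfM
    exact ⟨hs.labels_perm.symm.trans hM, hf', approx_trans ha ha'⟩

/-- The full cycles of maximal length on an odd number of letters form one `≈`-class. -/
theorem IsFullCycle.approx {h : ℕ} {σ τ : Perm (Fin (2 * h + 1))}
    (hσ : IsFullCycle σ) (hσn : noninvCount σ = h) (hτ : IsFullCycle τ)
    (hτn : noninvCount τ = h) : Approx σ τ := by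
  obtain ⟨K, hK, rfl⟩ := hσ.exists_word hσn
  obtain ⟨L, hL, rfl⟩ := hτ.exists_word hτn
  exact approx_trans ((wordEquiv_canonicalWord hK).approx hK hσ)
    (approx_symm ((wordEquiv_canonicalWord hL).approx hL hτ))

/-- The permutation `σ` exchanges the letters above the middle letter `h` with those below it, in
at least one of the two directions. -/
def Oscillates {h : ℕ} (σ : Perm (Fin (2 * h + 1))) : Prop :=
  (∀ x, (σ x : ℕ) < h ↔ h < (x : ℕ)) ∨ ∀ x, h < (σ x : ℕ) ↔ (x : ℕ) < h

/-- A full cycle of maximal length oscillates, since its word contains only one of the two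
generators that move the middle letter. -/
theorem IsFullCycle.oscillates {h : ℕ} {σ : Perm (Fin (2 * h + 1))} (hσ : IsFullCycle σ)
    (hn : noninvCount σ = h) : Oscillates σ := by
  obtain ⟨K, hK, rfl⟩ := hσ.exists_word hn
  have hlt := labels_lt hK
  have hnodup : (K.map Prod.fst).Nodup := hK.nodup_iff.2 List.nodup_range
  by_cases hmem : (h - 1, true) ∈ K
  · right
    have hnot : (h - 1, false) ∉ K := fun h' ↦ by
      simpa using List.inj_on_of_nodup_map hnodup hmem h' rfl
    have := wordPerm_lt_iff (h := h) (c := h + 1) (K := K) fun x hx ↦ by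
      have := hlt x hx
      obtain ⟨j, _ | _⟩ := x
      · have : j ≠ h - 1 := fun hj ↦ hnot (hj ▸ hx)
        simp only [Bool.false_eq_true, if_false]
        omega
      · simp only [if_true]
        omega
    intro x
    have := this x
    omega
  · left
    have := wordPerm_lt_iff (h := h) (c := h) (K := K) fun x hx ↦ by
      have := hlt x hx
      obtain ⟨j, _ | _⟩ := x
      · simp only [Bool.false_eq_true, if_false]
        omega
      · have : j ≠ h - 1 := fun hj ↦ hmem (hj ▸ hx)
        simp only [if_true]
        omega
    intro x
    have := this x
    omega

theorem one_le_stayCount {h : ℕ} (σ : Perm (Fin (2 * h + 1))) : 1 ≤ stayCount σ := by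
  by_contra hlt
  have hempty : stayCount σ = 0 := by omega
  rw [stayCount, card_eq_zero, filter_eq_empty_iff] at hempty
  -- Otherwise the `h + 1` lower letters would be mapped into the `h` upper letters.
  have hsub : (univ.filter fun x : Fin (2 * h + 1) ↦ (x : ℕ) < h + 1).map σ.toEmbedding ⊆
      univ.filter fun x : Fin (2 * h + 1) ↦ ¬ (x : ℕ) < h + 1 := by
    intro y hy
    obtain ⟨x, hx, rfl⟩ := mem_map.1 hy
    have := hempty (mem_univ x)
    rw [mem_filter] at hx ⊢
    refine ⟨mem_univ _, ?_⟩
    simp only [toEmbedding_apply]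
    omega
  have hcard := card_le_card hsub
  have hsum := card_filter_add_card_filter_not (s := (univ : Finset (Fin (2 * h + 1))))
    (fun x ↦ (x : ℕ) < h + 1)
  rw [card_map] at hcard
  rw [card_univ, Fintype.card_fin] at hsum
  have : #(univ.filter fun x : Fin (2 * h + 1) ↦ (x : ℕ) < h + 1) = h + 1 := by
    rw [Fin.card_filter_val_lt]
    omega
  omega

theorem Oscillates.stayCount_eq_one {h : ℕ} {σ : Perm (Fin (2 * h + 1))} (hσ : Oscillates σ) :
    stayCount σ = 1 := by
  rw [stayCount, card_eq_one]
  rcases hσ with hσ | hσ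
  · refine ⟨σ⁻¹ ⟨h, by omega⟩, ?_⟩
    ext x
    rw [mem_filter, mem_singleton, Perm.eq_inv_iff_eq, Fin.ext_iff]
    have := hσ x
    simp only [mem_univ, true_and]
    omega
  · refine ⟨⟨h, by omega⟩, ?_⟩
    ext x
    rw [mem_filter, mem_singleton, Fin.ext_iff]
    have := hσ x
    simp only [mem_univ, true_and]
    omega

theorem isFullCycle_stairCycle (n : ℕ) : IsFullCycle (stairCycle n) := sameCycle_stairCycle

theorem stairCycle_val {h : ℕ} (x : Fin (2 * h + 1)) :
    (stairCycle _ x : ℕ) =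
      if (x : ℕ) < h then 2 * h - x else if (x : ℕ) = h then 0 else 2 * h + 1 - x := by
  obtain ⟨p, rfl⟩ := stairSeq_surjective _ x
  have hp := p.2
  rw [stairCycle_stairSeq, stairSeq_val, stairSeq_val]
  by_cases hlast : (p : ℕ) + 1 = 2 * h + 1
  · simp only [hlast, Nat.mod_self]
    split_ifs <;> omega
  · simp only [Nat.mod_eq_of_lt (show (p : ℕ) + 1 < 2 * h + 1 by omega)]
    split_ifs <;> omega

theorem noninvCount_stairCycle (h : ℕ) : noninvCount (stairCycle (2 * h + 1)) = h := by
  refine le_antisymm ?_ (isFullCycle_stairCycle _).le_noninvCount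
  -- Both halves are mapped decreasingly, so the middle letter is part of every pair in order.
  have hsub : (univ.filter fun p : Fin (2 * h + 1) × Fin (2 * h + 1) ↦
      p.1 < p.2 ∧ stairCycle _ p.1 < stairCycle _ p.2) ⊆
      {⟨h, by omega⟩} ×ˢ Ioi (⟨h, by omega⟩ : Fin (2 * h + 1)) := by
    rintro ⟨x, y⟩ hxy
    obtain ⟨-, hlt, hlt'⟩ := mem_filter.1 hxy
    rw [mem_product, mem_singleton, mem_Ioi]
    simp only [Fin.lt_def, Fin.ext_iff] at *
    rw [stairCycle_val, stairCycle_val] at hlt'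
    split_ifs at hlt' <;> omega
  refine (card_le_card hsub).trans ?_
  simp
  omega

/-! ### Conjugation by the longest element -/

theorem w₀_conj_apply_rev {n : ℕ} (σ : Perm (Fin n)) (x : Fin n) :
    (w₀ n * σ * (w₀ n)⁻¹) x.rev = (σ x).rev := by
  rw [w₀_inv, Perm.mul_apply, Perm.mul_apply, w₀_apply, w₀_apply, Fin.rev_rev]

theorem w₀_conj_w₀_conj {n : ℕ} (σ : Perm (Fin n)) :
    w₀ n * (w₀ n * σ * (w₀ n)⁻¹) * (w₀ n)⁻¹ = σ := by
  rw [w₀_inv, ← mul_assoc, ← mul_assoc, w₀_mul_self, one_mul, mul_assoc, w₀_mul_self, mul_one]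

theorem noninvCount_w₀_conj {n : ℕ} (σ : Perm (Fin n)) :
    noninvCount (w₀ n * σ * (w₀ n)⁻¹) = noninvCount σ := by
  rw [noninvCount_eq_sum, noninvCount_eq_sum, sum_comm, ← Equiv.sum_comp Fin.revPerm]
  refine sum_congr rfl fun x _ ↦ ?_
  rw [← Equiv.sum_comp Fin.revPerm]
  refine sum_congr rfl fun y _ ↦ ?_
  simp only [Fin.revPerm_apply, w₀_conj_apply_rev, Fin.rev_lt_rev]

theorem BalancedStep.w₀_conj {n : ℕ} {σ τ : Perm (Fin n)} (h : BalancedStep σ τ) :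
    BalancedStep (w₀ n * σ * (w₀ n)⁻¹) (w₀ n * τ * (w₀ n)⁻¹) := by
  obtain ⟨i, j, hij, hbal, rfl⟩ := h
  refine ⟨j.rev, i.rev, by simp only [Fin.val_rev]; omega, ?_, ?_⟩
  · have : (w₀ n * σ * (w₀ n)⁻¹)⁻¹ = w₀ n * σ⁻¹ * (w₀ n)⁻¹ := by group
    simpa only [IsBalancedAt, this, w₀_conj_apply_rev, Fin.rev_lt_rev] using hbal
  · have : swap j.rev i.rev = w₀ n * swap i j * (w₀ n)⁻¹ := by
      rw [← swap_apply_apply, swap_comm]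
      rfl
    rw [this]
    group

theorem Approx.w₀_conj {n : ℕ} {σ τ : Perm (Fin n)} (h : Approx σ τ) :
    Approx (w₀ n * σ * (w₀ n)⁻¹) (w₀ n * τ * (w₀ n)⁻¹) :=
  h.induction (p := fun τ ↦ Approx (w₀ n * σ * (w₀ n)⁻¹) (w₀ n * τ * (w₀ n)⁻¹))
    (approx_refl _) fun _ _ hs hu ↦ approx_trans hu hs.w₀_conj.approx

theorem SameOrbits.w₀_conj {n : ℕ} {σ τ : Perm (Fin n)} (h : SameOrbits σ τ) :
    SameOrbits (w₀ n * σ * (w₀ n)⁻¹) (w₀ n * τ * (w₀ n)⁻¹) :=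
  fun x y ↦ by rw [Perm.sameCycle_conj, Perm.sameCycle_conj, h]

theorem mem_conjW₀ {n : ℕ} {X : Set (Perm (Fin n))} {σ : Perm (Fin n)} :
    σ ∈ conjW₀ X ↔ w₀ n * σ * (w₀ n)⁻¹ ∈ X := by
  constructor
  · rintro ⟨τ, hτ, rfl⟩
    rwa [w₀_conj_w₀_conj]
  · exact fun h ↦ ⟨_, h, w₀_conj_w₀_conj σ⟩

/-! ### Moving the middle letter through the inner block -/

section Slide

variable {h n₂ n : ℕ} (hn : (2 * h + 1) + n₂ = n)

/-- The arrangement of the two blocks of letters that is obtained from the one of the inductive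
product by moving the middle letter of the outer block past the first `j ≤ n₂` letters of the
inner block. -/
noncomputable def slideEquiv : ℕ → (Fin (2 * h + 1) ⊕ Fin n₂ ≃ Fin n)
  | 0 => phiEquiv hn
  | j + 1 => (slideEquiv j).trans (adj n (h + j))

theorem adj_val {n i : ℕ} (hi : i + 1 < n) (x : Fin n) :
    (adj n i x : ℕ) = if (x : ℕ) = i then i + 1 else if (x : ℕ) = i + 1 then i else x := by
  rw [adj, dif_pos hi, swap_apply_def]
  simp only [Fin.ext_iff]
  split_ifs <;> rfl

theorem slideEquiv_val {j : ℕ} (hj : j ≤ n₂) :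
    (∀ a : Fin (2 * h + 1), (slideEquiv hn j (.inl a) : ℕ) =
      if (a : ℕ) < h then (a : ℕ) else if (a : ℕ) = h then h + j else a + n₂) ∧
    ∀ b : Fin n₂, (slideEquiv hn j (.inr b) : ℕ) = if (b : ℕ) < j then b + h else b + h + 1 := by
  induction j with
  | zero =>
    refine ⟨fun a ↦ ?_, fun b ↦ ?_⟩
    · rw [slideEquiv, phiEquiv_inl]
      simp only [phi₁]
      split_ifs <;> simp only [] <;> omega
    · rw [slideEquiv, phiEquiv_inr]
      simp only [phi₂]
      split_ifs <;> omega
  | succ j ih =>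
    obtain ⟨ih₁, ih₂⟩ := ih (by omega)
    refine ⟨fun a ↦ ?_, fun b ↦ ?_⟩
    · rw [slideEquiv, trans_apply, adj_val (by omega), ih₁]
      split_ifs <;> omega
    · rw [slideEquiv, trans_apply, adj_val (by omega), ih₂]
      split_ifs <;> omega

/-- The middle letter of an oscillating permutation, unless it is fixed, is mapped to one half and
is the image of a letter of the other half. -/
theorem Oscillates.middle {σ : Perm (Fin (2 * h + 1))} (hσ : Oscillates σ) {m : Fin (2 * h + 1)}
    (hm : (m : ℕ) = h) (hne : σ m ≠ m) :
    (σ m : ℕ) < h ∧ h < (σ⁻¹ m : ℕ) ∨ h < (σ m : ℕ) ∧ (σ⁻¹ m : ℕ) < h := by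
  have hne' : (σ⁻¹ m : ℕ) ≠ m := fun h' ↦ hne (Perm.inv_eq_iff_eq.1 (Fin.ext h')).symm
  rw [ne_eq, Fin.ext_iff] at hne
  rcases hσ with hσ | hσ
  · have h₁ := hσ m
    have h₂ := hσ (σ⁻¹ m)
    rw [apply_inv_apply] at h₂
    omega
  · have h₁ := hσ m
    have h₂ := hσ (σ⁻¹ m)
    rw [apply_inv_apply] at h₂
    omega

theorem BalancedStep.slide {σ₁ : Perm (Fin (2 * h + 1))} (hσ : Oscillates σ₁)
    {m : Fin (2 * h + 1)} (hm : (m : ℕ) = h) (hne : σ₁ m ≠ m) (σ₂ : Perm (Fin n₂)) {j : ℕ}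
    (hj : j < n₂) :
    BalancedStep (blockPerm (slideEquiv hn j) σ₁ σ₂) (blockPerm (slideEquiv hn (j + 1)) σ₁ σ₂) := by
  obtain ⟨h₁, h₂⟩ := slideEquiv_val hn hj.le
  have hi : h + j + 1 < n := by omega
  have hem : slideEquiv hn j (.inl m) = ⟨h + j, by omega⟩ := Fin.ext (by simp [h₁, hm])
  have hej : slideEquiv hn j (.inr ⟨j, hj⟩) = ⟨h + j + 1, hi⟩ := Fin.ext (by simp [h₂]; omega)
  refine ⟨slideEquiv hn j (.inl m), slideEquiv hn j (.inr ⟨j, hj⟩), by rw [hem, hej], ?_, ?_⟩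
  · simp only [IsBalancedAt, blockPerm_inv, blockPerm_inl, blockPerm_inr, Fin.lt_def]
    rw [h₁, h₁, h₂, h₂]
    have := (σ₂ ⟨j, hj⟩).2
    have := (σ₂⁻¹ ⟨j, hj⟩).2
    have := hσ.middle hm hne
    split_ifs <;> omega
  · rw [hem, hej]
    have : adj n (h + j) = swap ⟨h + j, by omega⟩ ⟨h + j + 1, hi⟩ := by rw [adj, dif_pos hi]
    rw [← this, slideEquiv, ← conj_blockPerm, inv_eq_of_mul_eq_one_left (adj_mul_self _ _)]

theorem Oscillates.approx_slide {σ₁ : Perm (Fin (2 * h + 1))} (hσ : Oscillates σ₁)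
    {m : Fin (2 * h + 1)} (hm : (m : ℕ) = h) (hne : σ₁ m ≠ m) (σ₂ : Perm (Fin n₂)) :
    Approx (iprod hn σ₁ σ₂) (blockPerm (slideEquiv hn n₂) σ₁ σ₂) := by
  suffices ∀ j ≤ n₂, Approx (iprod hn σ₁ σ₂) (blockPerm (slideEquiv hn j) σ₁ σ₂) from
    this n₂ le_rfl
  intro j hj
  induction j with
  | zero => exact approx_refl _
  | succ j ih => exact approx_trans (ih (by omega)) (BalancedStep.slide hn hσ hm hne σ₂ hj).approx

theorem IsFullCycle.apply_ne {n : ℕ} {σ : Perm (Fin n)} (hσ : IsFullCycle σ) (hn : 1 < n)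
    (m : Fin n) : σ m ≠ m := by
  intro hm
  have := fun y ↦ hσ.forall_of_invariant (p := fun x ↦ x = m)
    (fun x ↦ by rw [← σ.injective.eq_iff (a := x), hm]) m y rfl
  have h₁ := Fin.ext_iff.1 ((this ⟨0, by omega⟩).trans (this ⟨1, hn⟩).symm)
  simp at h₁

theorem IsFullCycle.balancedStep {n : ℕ} {σ τ : Perm (Fin n)} (hσ : IsFullCycle σ)
    (hs : BalancedStep σ τ) : IsFullCycle τ := by
  obtain ⟨i, j, -, -, rfl⟩ := hs
  simpa only [swap_inv] using hσ.conj (swap i j)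

/-- Balanced steps between full cycles of maximal length lift to paths between inductive products.
A step at the middle letter `h` and its successor, which the inner block separates, is performed
after the middle letter has been moved through the inner block. -/
theorem BalancedStep.approx_iprod {σ₁ τ₁ : Perm (Fin (2 * h + 1))} (hs : BalancedStep σ₁ τ₁)
    (hσ : IsFullCycle σ₁) (hσn : noninvCount σ₁ = h) (σ₂ : Perm (Fin n₂)) :
    Approx (iprod hn σ₁ σ₂) (iprod hn τ₁ σ₂) := by
  have hτ := hσ.balancedStep hs
  have hτn : noninvCount τ₁ = h := (noninvCount_eq_iff.2 hs.invCount_eq).trans hσn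
  obtain ⟨a, b, hab, hbal, rfl⟩ := hs
  by_cases hb : (b : ℕ) = h + 1
  · have ha : (a : ℕ) = h := by omega
    have hlt : 1 < 2 * h + 1 := by omega
    refine approx_trans ((hσ.oscillates hσn).approx_slide hn ha (hσ.apply_ne hlt a) σ₂)
      (approx_trans ?_ (approx_symm
        ((hτ.oscillates hτn).approx_slide hn ha (hτ.apply_ne hlt a) σ₂)))
    obtain ⟨h₁, -⟩ := slideEquiv_val hn le_rfl
    have hmono : StrictMono (slideEquiv hn n₂ ∘ .inl) := by
      intro x y hxy
      rw [Fin.lt_def] at hxy ⊢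
      rw [Function.comp_apply, Function.comp_apply, h₁, h₁]
      split_ifs <;> omega
    refine BalancedStep.approx ⟨slideEquiv hn n₂ (.inl a), slideEquiv hn n₂ (.inl b), ?_,
      (balanced_blockPerm_inl σ₁ σ₂ hmono).2 hbal, (swap_conj_blockPerm_inl _ σ₁ σ₂ a b).symm⟩
    rw [h₁, h₁]
    split_ifs <;> omega
  · exact (BalancedStep.iprod_left hn σ₂ hab (by omega) hbal).approx

theorem Approx.iprod_left_of_odd {σ₁ τ₁ : Perm (Fin (2 * h + 1))} (hs : Approx σ₁ τ₁)
    (hσ : IsFullCycle σ₁) (hσn : noninvCount σ₁ = h) (σ₂ : Perm (Fin n₂)) :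
    Approx (iprod hn σ₁ σ₂) (iprod hn τ₁ σ₂) := by
  refine (hs.induction (p := fun τ ↦ IsFullCycle τ ∧ noninvCount τ = h ∧
    Approx (iprod hn σ₁ σ₂) (iprod hn τ σ₂)) ⟨hσ, hσn, approx_refl _⟩ ?_).2.2
  rintro u v huv ⟨hu, hun, hu'⟩
  exact ⟨hu.balancedStep huv, (noninvCount_eq_iff.2 huv.invCount_eq).trans hun,
    approx_trans hu' (huv.approx_iprod hn hu hun σ₂)⟩

end Slide

/-! ### The case of odd parts -/

section Odd

variable {n₁ n₂ n : ℕ} (hn : n₁ + n₂ = n)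

theorem SameOrbits.isFullCycle {σ : Perm (Fin n)} (h : SameOrbits σ (stairCycle n)) :
    IsFullCycle σ :=
  fun x y ↦ (h x y).2 (sameCycle_stairCycle x y)

/-- An inductive product has maximal length for its orbits if and only if its factors do: the pairs
with one letter in each block contribute least when the left factor is a full cycle of maximal
length. -/
theorem noninvCount_iprod_eq_iff (h₁ : Odd n₁) {σ₁ : Perm (Fin n₁)} {σ₂ τ₂ : Perm (Fin n₂)}
    (hσ₁ : IsFullCycle σ₁) (hσ₂ : noninvCount τ₂ ≤ noninvCount σ₂) :
    noninvCount (iprod hn (stairCycle n₁) τ₂) ≤ noninvCount (iprod hn σ₁ σ₂) ∧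
      (noninvCount (iprod hn σ₁ σ₂) = noninvCount (iprod hn (stairCycle n₁) τ₂) ↔
        noninvCount σ₁ = noninvCount (stairCycle n₁) ∧ noninvCount σ₂ = noninvCount τ₂) := by
  obtain ⟨h, rfl⟩ := h₁
  have hstair := noninvCount_stairCycle h
  have hone := ((isFullCycle_stairCycle _).oscillates hstair).stayCount_eq_one
  have hle := hσ₁.le_noninvCount
  rw [noninvCount_iprod, noninvCount_iprod, hone, hstair, mul_one]
  have hstay : n₂ ≤ n₂ * stayCount σ₁ := Nat.le_mul_of_pos_right _ (one_le_stayCount σ₁)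
  have hstay' : noninvCount σ₁ = h → n₂ * stayCount σ₁ = n₂ := fun h' ↦ by
    rw [(hσ₁.oscillates h').stayCount_eq_one, mul_one]
  omega

theorem approx_iprod_of_odd (h₁ : Odd n₁) {σ₁ : Perm (Fin n₁)} {σ₂ τ₂ : Perm (Fin n₂)}
    (hσ₁ : IsFullCycle σ₁) (hσn : noninvCount σ₁ = noninvCount (stairCycle n₁))
    (hσ₂ : Approx τ₂ σ₂) : Approx (iprod hn (stairCycle n₁) τ₂) (iprod hn σ₁ σ₂) := by
  obtain ⟨h, rfl⟩ := h₁
  have hstair := noninvCount_stairCycle h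
  have hfull := isFullCycle_stairCycle (2 * h + 1)
  exact approx_trans (hσ₂.iprod_right hn _)
    ((hfull.approx hstair hσ₁ (hσn.trans hstair)).iprod_left_of_odd hn hfull hstair σ₂)

end Odd

/-- If all parts are odd, then among the permutations with the same orbits as the element in stair
form, this element has maximal length, and all those of the same length belong to its class. -/
theorem noninvCount_stairForm_le_and_approx {n : ℕ} (α : Composition n)
    (hodd : ∀ a ∈ α.blocks, Odd a) {σ : Perm (Fin n)} (hσ : SameOrbits σ (stairForm α)) :
    noninvCount (stairForm α) ≤ noninvCount σ ∧
      (noninvCount σ = noninvCount (stairForm α) → Approx (stairForm α) σ) := by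
  induction hk : α.length generalizing n with
  | zero =>
    have hb : α.blocks = [] := List.length_eq_zero_iff.1 hk
    obtain rfl : n = 0 := by simpa [hb] using α.blocks_sum.symm
    obtain rfl : σ = stairForm α := Subsingleton.elim _ _
    exact ⟨le_rfl, fun _ ↦ approx_refl _⟩
  | succ k ih =>
    have hl : 1 ≤ α.length := by omega
    have h₁ : Odd (firstPart α hl) := hodd _ (List.head_mem _)
    rw [stairForm_eq_iprod_of_odd α hl h₁, stairForm_firstComp] at hσ ⊢
    obtain ⟨σ₁, σ₂, rfl⟩ := hσ.exists_blockPerm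
    obtain ⟨hσ₁, hσ₂⟩ := sameOrbits_blockPerm.1 hσ
    have hσ₂' := hσ₂.w₀_conj
    rw [w₀_conj_w₀_conj] at hσ₂'
    obtain ⟨hle, happ⟩ := ih (restComp α) (fun a ha ↦ hodd a (List.mem_of_mem_tail ha)) hσ₂' (by
      have : (restComp α).length = α.length - 1 := List.length_tail
      omega)
    rw [noninvCount_w₀_conj] at hle happ
    obtain ⟨hle', hiff⟩ := noninvCount_iprod_eq_iff (firstPart_add_restSize α hl) h₁
      (σ₂ := σ₂) (τ₂ := w₀ _ * stairForm (restComp α) * (w₀ _)⁻¹) hσ₁.isFullCycle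
      (by rwa [noninvCount_w₀_conj])
    refine ⟨hle', fun heq ↦ ?_⟩
    obtain ⟨he₁, he₂⟩ := hiff.1 heq
    rw [noninvCount_w₀_conj] at he₂
    have := (happ he₂).w₀_conj
    rw [w₀_conj_w₀_conj] at this
    exact approx_iprod_of_odd _ h₁ hσ₁.isFullCycle he₁ this

theorem mem_sigmaCross_iff {n : ℕ} {α : Composition n} (hodd : ∀ a ∈ α.blocks, Odd a)
    {σ : Perm (Fin n)} : σ ∈ SigmaCross α ↔
      SameOrbits σ (stairForm α) ∧ noninvCount σ = noninvCount (stairForm α) := by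
  constructor
  · rintro ⟨h, h'⟩
    exact ⟨orbitPartition_eq_iff.1 h', noninvCount_eq_iff.2 (Approx.invCount_eq h)⟩
  · rintro ⟨h, h'⟩
    exact ⟨(noninvCount_stairForm_le_and_approx α hodd h).2 h', orbitPartition_eq_iff.2 h⟩

theorem sigmaCross_eq_iprodSet {n : ℕ} (α : Composition n) (hl : 1 ≤ α.length)
    (hodd : ∀ a ∈ α.blocks, Odd a) :
    SigmaCross α = iprodSet (firstPart_add_restSize α hl) (SigmaCross (firstComp α hl))
      (conjW₀ (SigmaCross (restComp α))) := by
  have h₁ : Odd (firstPart α hl) := hodd _ (List.head_mem _)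
  have hfirst : ∀ a ∈ (firstComp α hl).blocks, Odd a := by simpa [firstComp] using h₁
  have hrest : ∀ a ∈ (restComp α).blocks, Odd a := fun a ha ↦ hodd a (List.mem_of_mem_tail ha)
  -- Having the right orbits is a condition on the factors, and so is having maximal length then.
  have key (σ₁ : Perm (Fin (firstPart α hl))) (σ₂ : Perm (Fin (restSize α))) :
      iprod (firstPart_add_restSize α hl) σ₁ σ₂ ∈ SigmaCross α ↔
        σ₁ ∈ SigmaCross (firstComp α hl) ∧ σ₂ ∈ conjW₀ (SigmaCross (restComp α)) := by
    rw [mem_conjW₀, mem_sigmaCross_iff hodd, mem_sigmaCross_iff hfirst, mem_sigmaCross_iff hrest,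
      stairForm_eq_iprod_of_odd α hl h₁, noninvCount_w₀_conj, stairForm_firstComp,
      iprod_eq_blockPerm, iprod_eq_blockPerm, sameOrbits_blockPerm]
    have horb : SameOrbits σ₂ (w₀ _ * stairForm (restComp α) * (w₀ _)⁻¹) ↔
        SameOrbits (w₀ _ * σ₂ * (w₀ _)⁻¹) (stairForm (restComp α)) :=
      ⟨fun h ↦ by simpa only [w₀_conj_w₀_conj] using h.w₀_conj,
        fun h ↦ by simpa only [w₀_conj_w₀_conj] using h.w₀_conj⟩
    rw [horb, and_and_and_comm]
    refine and_congr_right ?_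
    rintro ⟨ho₁, ho₂⟩
    have hle := (noninvCount_stairForm_le_and_approx _ hrest ho₂).1
    rw [noninvCount_w₀_conj] at hle
    have := (noninvCount_iprod_eq_iff (firstPart_add_restSize α hl) h₁ ho₁.isFullCycle
      (σ₂ := σ₂) (τ₂ := w₀ _ * stairForm (restComp α) * (w₀ _)⁻¹) (by rwa [noninvCount_w₀_conj])).2
    rwa [noninvCount_w₀_conj] at this
  ext σ
  constructor
  · intro hσ
    have ho := (mem_sigmaCross_iff hodd).1 hσ
    rw [stairForm_eq_iprod_of_odd α hl h₁] at ho
    obtain ⟨σ₁, σ₂, rfl⟩ := ho.1.exists_blockPerm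
    obtain ⟨hσ₁, hσ₂⟩ := (key σ₁ σ₂).1 hσ
    exact ⟨σ₁, hσ₁, σ₂, hσ₂, rfl⟩
  · rintro ⟨σ₁, hσ₁, σ₂, hσ₂, rfl⟩
    exact (key σ₁ σ₂).2 ⟨hσ₁, hσ₂⟩

theorem IsMaximal.odd_of_odd_firstPart {n : ℕ} {α : Composition n} (hα : IsMaximal α)
    (hl : 1 ≤ α.length) (h₁ : Odd (firstPart α hl)) : ∀ a ∈ α.blocks, Odd a := by
  obtain ⟨k, -, heven, hodd, -⟩ := hα
  cases k with
  | zero => simpa using hodd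
  | succ k =>
    have hmem : firstPart α hl ∈ α.blocks.take (k + 1) := by
      have hne : α.blocks ≠ [] := List.length_pos_iff.mp hl
      rw [← List.cons_head_tail hne, List.take_succ_cons]
      exact List.mem_cons_self
    exact absurd (heven _ hmem) (Nat.not_even_iff_odd.2 h₁)

theorem iprod_injective {n₁ n₂ n : ℕ} (h : n₁ + n₂ = n) :
    Function.Injective fun p : Perm (Fin n₁) × Perm (Fin n₂) ↦ iprod h p.1 p.2 :=
  blockPerm_injective _

theorem bijOn_iprod {n₁ n₂ n : ℕ} (h : n₁ + n₂ = n) (X₁ : Set (Perm (Fin n₁)))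
    (X₂ : Set (Perm (Fin n₂))) :
    Set.BijOn (fun p ↦ iprod h p.1 p.2) (X₁ ×ˢ X₂) (iprodSet h X₁ X₂) := by
  refine ⟨fun p hp ↦ ⟨p.1, hp.1, p.2, hp.2, rfl⟩, (iprod_injective h).injOn, ?_⟩
  rintro _ ⟨σ₁, hσ₁, σ₂, hσ₂, rfl⟩
  exact ⟨(σ₁, σ₂), ⟨hσ₁, hσ₂⟩, rfl⟩

end InductiveProduct

theorem mainTheorem8 {n : ℕ} (α : Composition n) (hα : IsMaximal α) (hl : 1 ≤ α.length) :
    Function.Injective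
      (fun p : Equiv.Perm (Fin (firstPart α hl)) × Equiv.Perm (Fin (restSize α)) ↦
        iprod (firstPart_add_restSize α hl) p.1 p.2) ∧
    (Even (firstPart α hl) →
      SigmaClass α = iprodSet (firstPart_add_restSize α hl)
        (SigmaClass (firstComp α hl)) (SigmaClass (restComp α)) ∧
      Set.BijOn (fun p ↦ iprod (firstPart_add_restSize α hl) p.1 p.2)
        (SigmaClass (firstComp α hl) ×ˢ SigmaClass (restComp α))
        (SigmaClass α)) ∧
    (Odd (firstPart α hl) →
      SigmaCross α = iprodSet (firstPart_add_restSize α hl)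
        (SigmaCross (firstComp α hl)) (conjW₀ (SigmaCross (restComp α))) ∧
      Set.BijOn (fun p ↦ iprod (firstPart_add_restSize α hl) p.1 p.2)
        (SigmaCross (firstComp α hl) ×ˢ conjW₀ (SigmaCross (restComp α)))
        (SigmaCross α)) := by
  refine ⟨iprod_injective _, fun h₁ ↦ ?_, fun h₁ ↦ ?_⟩
  · have h := sigmaClass_eq_iprodSet α hl h₁
    exact ⟨h, h ▸ bijOn_iprod _ _ _⟩
  · have h := sigmaCross_eq_iprodSet α hl (hα.odd_of_odd_firstPart hl h₁)
    exact ⟨h, h ▸ bijOn_iprod _ _ _⟩
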